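/- Let $d\in\mathbb N$, let $\Lambda$ be an index set, and let $\{\psi_\lambda\}_{\lambda\in\Lambda}\subset L^2(\mathbb R^d)$ be real-valued functions. With $\hat f(\xi)=\int_{\mathbb R^d} f(x)e^{-2\pi i x\cdot\xi}\,dx$ (extended to $L^2$), put $F_\lambda:=\operatorname{supp}\hat\psi_\lambda$, the complement of the largest open set on which $\hat\psi_\lambda=0$ almost everywhere, and let $|F_\lambda|$ be its Lebesgue measure. Assume: (i) each $F_\lambda$ is compact, and $\{\psi_\lambda(\cdot-u)\}_{u\in\mathbb R^d,\lambda\in\Lambda}$ is a semi-discrete frame, i.e. there are constants $A,B>0$ with $$A\|f\|_2^2\le\sum_{\lambda\in\Lambda}\|f\ast\psi_\lambda\|_2^2\le B\|f\|_2^2\qquad\text{for all } f\in L^2(\mathbb R^d);$$ (ii) (good Fourier-support overlap) there are non-empty open sets $U_\lambda\subseteq F_\lambda$, $\lambda\in\Lambda$, with $\bigcup_{\lambda\in\Lambda}U_\lambda=\mathbb R^d$; (iii) for each $\lambda$, $X_\lambda=\{x_{\lambda,n}\}_{n\in\mathbb Z^d}$ is a sign-blind sampling set for $F_\lambda$: $x_{\lambda,n}=(M_\lambda^{\top})^{-1}\operatorname{diag}(2s_{\lambda,1},\dots,2s_{\lambda,d})^{-1}n$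 with a non-singular real $d\times d$ matrix $M_\lambda$ such that $F_\lambda\subseteq M_\lambda[-\tfrac12,\tfrac12]^d$ and real numbers $s_{\lambda,1},\dots,s_{\lambda,d}\ge1$. Let $C\subset\mathbb R^d$ be compact. Let $L^2(C,\mathbb R)$ be the space of real-valued square-integrable functions on $C$, extended by zero to $\mathbb R^d$, and equip $L^2(C,\mathbb R)/\{-1,1\}$ (identifying $f$ with $-f$) with the metric $\min\{\|f-g\|_{L^2},\|f+g\|_{L^2}\}$. Consider the sampling operator $$T(f)=\bigl(|F_\lambda|^{-1/2}\,|(f\ast\psi_\lambda)(x_{\lambda,n})|\bigr)_{(\lambda,n)\in\Lambda\times\mathbb Z^d}\in\ell^2(\Lambda\times\mathbb Z^d),$$ defined on the set $D(T)$ of all classes $f\in L^2(C,\mathbb R)/\{-1,1\}$ for which this family is square summable. Then: (a) if $\sup_{\lambda\in\Lambda}|F_\lambda|^{-1}\,|\det M_\lambda|\prod_{j=1}^d s_{\lambda,j}<\infty$, then $D(T)=L^2(C,\mathbb R)/\{-1,1\}$; (b) without this assumption, $T:D(T)\to\ell^2(\Lambda\times\mathbb Z^d)$ is injective, its range $\mathcal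 R(T)=T(D(T))$ is closed in $\ell^2(\Lambda\times\mathbb Z^d)$, and the inverse map $T^{-1}:\mathcal R(T)\to L^2(C,\mathbb R)/\{-1,1\}$ is continuous. In particular, whenever $T$ maps all of $L^2(C,\mathbb R)/\{-1,1\}$ into $\ell^2(\Lambda\times\mathbb Z^d)$, it is injective on $L^2(C,\mathbb R)/\{-1,1\}$ with closed range and continuous inverse on its range. -/

import Mathlib

open MeasureTheory Set Topology
open scoped ENNReal FourierTransform

noncomputable section

namespace SignRetrieval

/-! ### The quotient of a normed space by a global sign -/

/-- `f ∼ g` iff `f = ± g`. -/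
def signSetoid (V : Type*) [AddCommGroup V] : Setoid V where
  r f g := f = g ∨ f = -g
  iseqv :=
    { refl := fun _ => Or.inl rfl
      symm := by
        rintro f g (h | h)
        · exact Or.inl h.symm
        · exact Or.inr (by rw [h, neg_neg])
      trans := by
        rintro f g k (h | h) (h' | h')
        · exact Or.inl (h.trans h')
        · exact Or.inr (h.trans h')
        · exact Or.inr (by rw [h, h'])
        · exact Or.inl (by rw [h, h', neg_neg]) }

/-- The quotient `V / {-1, 1}`. -/
def SignQuotient (V : Type*) [AddCommGroup V] : Type _ := Quotient (signSetoid V)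

namespace SignQuotient

/-- The class `{f, -f}` of `f`. -/
def mk {V : Type*} [AddCommGroup V] (f : V) : SignQuotient V := Quotient.mk (signSetoid V) f

theorem eq_or_eq_neg_of_mk_eq {V : Type*} [AddCommGroup V] {f g : V} (h : mk f = mk g) :
    f = g ∨ f = -g :=
  Quotient.exact h

/-- The distance `min (‖f - g‖) (‖f + g‖)` between the classes of `f` and `g`. -/
def signDist {V : Type*} [NormedAddCommGroup V] (p q : SignQuotient V) : ℝ :=
  Quotient.liftOn₂ p q (fun f g => min ‖f - g‖ ‖f + g‖) (by
    rintro f g f' g' (rfl | rfl) (rfl | rfl)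
    · rfl
    · simp only [sub_neg_eq_add, ← sub_eq_add_neg, min_comm]
    · rw [min_comm, show -f' + g = -(f' - g) by abel, show -f' - g = -(f' + g) by abel,
        norm_neg, norm_neg]
    · rw [show -f' - -g' = -(f' - g') by abel, show -f' + -g' = -(f' + g') by abel,
        norm_neg, norm_neg])

instance {V : Type*} [NormedAddCommGroup V] : MetricSpace (SignQuotient V) where
  dist := signDist
  dist_self := by
    rintro ⟨f⟩
    change min ‖f - f‖ ‖f + f‖ = 0
    simp
  dist_comm := by
    rintro ⟨f⟩ ⟨g⟩
    change min ‖f - g‖ ‖f + g‖ = min ‖g - f‖ ‖g + f‖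
    rw [norm_sub_rev, add_comm]
  dist_triangle := by
    rintro ⟨f⟩ ⟨g⟩ ⟨k⟩
    change min ‖f - k‖ ‖f + k‖ ≤ min ‖f - g‖ ‖f + g‖ + min ‖g - k‖ ‖g + k‖
    have h1 : ‖f - k‖ ≤ ‖f - g‖ + ‖g - k‖ := norm_sub_le_norm_sub_add_norm_sub f g k
    have h2 : ‖f + k‖ ≤ ‖f - g‖ + ‖g + k‖ := by
      have := norm_add_le (f - g) (g + k)
      rwa [show f - g + (g + k) = f + k by abel] at this
    have h3 : ‖f + k‖ ≤ ‖f + g‖ + ‖g - k‖ := by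
      have := norm_sub_le (f + g) (g - k)
      rwa [show f + g - (g - k) = f + k by abel] at this
    have h4 : ‖f - k‖ ≤ ‖f + g‖ + ‖g + k‖ := by
      have := norm_sub_le (f + g) (g + k)
      rwa [show f + g - (g + k) = f - k by abel] at this
    have h5 := min_le_left ‖f - k‖ ‖f + k‖
    have h6 := min_le_right ‖f - k‖ ‖f + k‖
    rcases min_choice ‖f - g‖ ‖f + g‖ with h | h <;>
      rcases min_choice ‖g - k‖ ‖g + k‖ with h' | h' <;> rw [h, h'] <;> linarith
  eq_of_dist_eq_zero := by
    rintro ⟨f⟩ ⟨g⟩ h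
    change min ‖f - g‖ ‖f + g‖ = 0 at h
    apply Quotient.sound
    rcases min_choice ‖f - g‖ ‖f + g‖ with h' | h' <;> rw [h'] at h
    · exact Or.inl (sub_eq_zero.1 (norm_eq_zero.1 h))
    · exact Or.inr (eq_neg_of_add_eq_zero_left (norm_eq_zero.1 h))

theorem dist_mk {V : Type*} [NormedAddCommGroup V] (f g : V) :
    dist (mk f) (mk g) = min ‖f - g‖ ‖f + g‖ := rfl

end SignQuotient

/-! ### Semi-discrete frames -/

variable {d : ℕ} {Λ : Type*}

/-- The convolution `f ∗ ψ`, `(f ∗ ψ)(x) = ∫ f(t) ψ(x - t) dt`, of a vector-valued function `f`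
with a real-valued function `ψ`. -/
def conv {V : Type*} [NormedAddCommGroup V] [NormedSpace ℝ V]
    (f : EuclideanSpace ℝ (Fin d) → V) (ψ : EuclideanSpace ℝ (Fin d) → ℝ) :
    EuclideanSpace ℝ (Fin d) → V :=
  convolution f ψ (ContinuousLinearMap.lsmul ℝ ℝ : ℝ →L[ℝ] V →L[ℝ] V).flip volume

/-- The Fourier transform of a real-valued `L²` function, as a complex-valued `L²` function. -/
def fourierL2 (ψ : Lp ℝ 2 (volume : Measure (EuclideanSpace ℝ (Fin d)))) :
    Lp ℂ 2 (volume : Measure (EuclideanSpace ℝ (Fin d))) :=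
  𝓕 (Complex.ofRealCLM.compLp ψ)

/-- The support of an `L²` function: the complement of the largest open set on which it vanishes
almost everywhere. -/
def essSupport (g : Lp ℂ 2 (volume : Measure (EuclideanSpace ℝ (Fin d)))) :
    Set (EuclideanSpace ℝ (Fin d)) :=
  {ξ | ∀ U ∈ 𝓝 ξ, 0 < volume (U ∩ Function.support g)}

/-- `F_ψ = supp ψ̂`. -/
def fourierSupport (ψ : Lp ℝ 2 (volume : Measure (EuclideanSpace ℝ (Fin d)))) :
    Set (EuclideanSpace ℝ (Fin d)) :=
  essSupport (fourierL2 ψ)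

/-- `{ψ_λ(· - u)}` is a semi-discrete frame of real-valued band-limited functions: each `supp ψ̂_λ`
is compact, and `A ‖f‖² ≤ ∑_λ ‖f ∗ ψ_λ‖² ≤ B ‖f‖²` for all `f ∈ L²(ℝᵈ)` and some `A, B > 0`. -/
structure IsBandLimitedFrame
    (ψ : Λ → Lp ℝ 2 (volume : Measure (EuclideanSpace ℝ (Fin d)))) : Prop where
  bandLimited : ∀ l, IsCompact (fourierSupport (ψ l))
  frame : ∃ A B : ℝ, 0 < A ∧ 0 < B ∧
    ∀ f : Lp ℂ 2 (volume : Measure (EuclideanSpace ℝ (Fin d))),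
      ENNReal.ofReal (A * ‖f‖ ^ 2) ≤ ∑' l, eLpNorm (conv f (ψ l)) 2 volume ^ 2 ∧
      ∑' l, eLpNorm (conv f (ψ l)) 2 volume ^ 2 ≤ ENNReal.ofReal (B * ‖f‖ ^ 2)

/-- Good Fourier-support overlap: there are nonempty open sets `U_λ` inside `supp ψ̂_λ` that cover
the whole space. -/
def GoodFSupportOverlap
    (ψ : Λ → Lp ℝ 2 (volume : Measure (EuclideanSpace ℝ (Fin d)))) : Prop :=
  ∃ U : Λ → Set (EuclideanSpace ℝ (Fin d)),
    (∀ l, (U l).Nonempty ∧ IsOpen (U l) ∧ U l ⊆ fourierSupport (ψ l)) ∧ ⋃ l, U l = univ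

/-! ### Sign-blind sampling sets -/

/-- The cube `[-1/2, 1/2]ᵈ`. -/
def cube (d : ℕ) : Set (EuclideanSpace ℝ (Fin d)) := {x | ∀ i, |x i| ≤ 1 / 2}

/-- The point `(Mᵀ)⁻¹ D[2s]⁻¹ n` of the lattice `(Mᵀ)⁻¹ D[2s]⁻¹ ℤᵈ`. -/
def latticePoint (M : Matrix (Fin d) (Fin d) ℝ) (s : Fin d → ℝ) (n : Fin d → ℤ) :
    EuclideanSpace ℝ (Fin d) :=
  WithLp.toLp 2 ((M.transpose)⁻¹.mulVec
    ((Matrix.diagonal fun i => 2 * s i)⁻¹.mulVec fun i => (n i : ℝ)))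

/-- The lattice `(Mᵀ)⁻¹ D[2s]⁻¹ ℤᵈ` is a sign-blind sampling set for `F`. -/
structure IsSignBlind (F : Set (EuclideanSpace ℝ (Fin d)))
    (M : Matrix (Fin d) (Fin d) ℝ) (s : Fin d → ℝ) : Prop where
  det_ne_zero : M.det ≠ 0
  subset : F ⊆ (fun x => Matrix.toEuclideanLin M x) '' cube d
  one_le : ∀ i, 1 ≤ s i

/-! ### The sampling operator -/

/-- `L²(C, ℝ)`. -/
abbrev L2On (C : Set (EuclideanSpace ℝ (Fin d))) : Type :=
  Lp ℝ 2 ((volume : Measure (EuclideanSpace ℝ (Fin d))).restrict C)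

/-- `f ∗ ψ` for `f ∈ L²(C, ℝ)`, extended by zero outside `C`. -/
def convOn {C : Set (EuclideanSpace ℝ (Fin d))} (f : L2On C)
    (ψ : EuclideanSpace ℝ (Fin d) → ℝ) : EuclideanSpace ℝ (Fin d) → ℝ :=
  conv (C.indicator f) ψ

theorem convOn_neg {C : Set (EuclideanSpace ℝ (Fin d))} (hC : MeasurableSet C) (f : L2On C)
    (ψ : EuclideanSpace ℝ (Fin d) → ℝ) (x : EuclideanSpace ℝ (Fin d)) :
    convOn (-f) ψ x = -convOn f ψ x := by
  unfold convOn conv convolution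
  rw [← integral_neg]
  refine integral_congr_ae ?_
  filter_upwards [(ae_restrict_iff' hC).1 (Lp.coeFn_neg f)] with t ht
  by_cases h : t ∈ C
  · rw [indicator_of_mem h, indicator_of_mem h, ht h]
    simp
  · simp [h]

/-- The samples `|F_λ|^{-1/2} |f ∗ ψ_λ|(x_{λ,n})`, `(λ, n) ∈ Λ × ℤᵈ`. -/
def samples (ψ : Λ → Lp ℝ 2 (volume : Measure (EuclideanSpace ℝ (Fin d))))
    (M : Λ → Matrix (Fin d) (Fin d) ℝ) (s : Λ → Fin d → ℝ)
    {C : Set (EuclideanSpace ℝ (Fin d))} (f : L2On C) : Λ × (Fin d → ℤ) → ℝ := fun p =>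
  volume.real (fourierSupport (ψ p.1)) ^ (-(1 / 2) : ℝ) *
    |convOn f (ψ p.1) (latticePoint (M p.1) (s p.1) p.2)|

/-- The samples of a class in `L²(C, ℝ) / {-1, 1}`. -/
def signSamples (ψ : Λ → Lp ℝ 2 (volume : Measure (EuclideanSpace ℝ (Fin d))))
    (M : Λ → Matrix (Fin d) (Fin d) ℝ) (s : Λ → Fin d → ℝ)
    {C : Set (EuclideanSpace ℝ (Fin d))} (hC : IsCompact C) (q : SignQuotient (L2On C)) :
    Λ × (Fin d → ℤ) → ℝ :=
  Quotient.liftOn q (samples ψ M s) (by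
    rintro f g (rfl | rfl)
    · rfl
    · funext p
      simp only [samples, convOn_neg hC.measurableSet, abs_neg])

/-- The classes in `L²(C, ℝ) / {-1, 1}` whose samples are square summable. -/
def samplingDomain (ψ : Λ → Lp ℝ 2 (volume : Measure (EuclideanSpace ℝ (Fin d))))
    (M : Λ → Matrix (Fin d) (Fin d) ℝ) (s : Λ → Fin d → ℝ)
    {C : Set (EuclideanSpace ℝ (Fin d))} (hC : IsCompact C) : Set (SignQuotient (L2On C)) :=
  {q | Memℓp (signSamples ψ M s hC q) 2}

/-- The sampling operator `T`, with values in `ℓ²(Λ × ℤᵈ)`. -/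
def samplingOp (ψ : Λ → Lp ℝ 2 (volume : Measure (EuclideanSpace ℝ (Fin d))))
    (M : Λ → Matrix (Fin d) (Fin d) ℝ) (s : Λ → Fin d → ℝ)
    {C : Set (EuclideanSpace ℝ (Fin d))} (hC : IsCompact C) (q : samplingDomain ψ M s hC) :
    lp (fun _ : Λ × (Fin d → ℤ) => ℝ) 2 :=
  ⟨signSamples ψ M s hC q, q.2⟩

end SignRetrieval

end

/-!
If `|f ∗ ψ_λ|` and `|g ∗ ψ_λ|` agree on a sign-blind sampling set, then the function
`((f - g) ∗ ψ_λ) ((f + g) ∗ ψ_λ)` vanishes there. Its spectrum lies in `F_λ + F_λ`, for which the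
sampling set is still dense enough, so it vanishes identically. Both factors are real-analytic along
lines, hence one of them is zero, say `(f ∓ g) ∗ ψ_λ = 0`. Since `f ∓ g` has compact support, its
Fourier transform is analytic too and cannot vanish on a set of positive measure unless `f = ± g`.

Sampling turns the semi-discrete frame into a discrete one: summing the squares over the lattice
multiplies `‖f ∗ ψ_λ‖²` by a ratio that is at least one. So the linear map with coordinates
`|F_λ|^{-1/2} (f ∗ ψ_λ)(x_{λ,n})` is a closed operator bounded below. Taking absolute values of the
coordinates is a proper map of `ℓ²`, because the norms of the coordinates control the tails.
Therefore the sampling operator is a closed map.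
-/

namespace SignRetrieval

open Filter

/-! ### Coordinatewise norms in `ℓᵖ` and frame coefficients -/

section CoordNorm

variable {ι : Type*} {E : ι → Type*} [∀ i, NormedAddCommGroup (E i)] {p : ℝ≥0∞}

/-- The nonlinear map `(xᵢ)ᵢ ↦ (‖xᵢ‖)ᵢ` of `ℓᵖ`, which discards the phases of the coordinates. -/
def coordNorm (x : lp E p) : lp (fun _ : ι => ℝ) p := ⟨fun i => ‖x i‖, (lp.memℓp x).norm⟩

theorem lipschitzWith_coordNorm [Fact (1 ≤ p)] :
    LipschitzWith 1 (coordNorm : lp E p → lp (fun _ : ι => ℝ) p) := by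
  refine LipschitzWith.of_dist_le_mul fun x y => ?_
  rw [NNReal.coe_one, one_mul, dist_eq_norm, dist_eq_norm]
  exact lp.norm_mono (zero_lt_one.trans_le Fact.out).ne' fun i => abs_norm_sub_norm_le (x i) (y i)

theorem norm_coordNorm (hp : p ≠ 0) (x : lp E p) : ‖coordNorm x‖ = ‖x‖ :=
  le_antisymm (lp.norm_mono hp fun i => (norm_norm (x i)).le)
    (lp.norm_mono hp fun i => (norm_norm (x i)).ge)

theorem norm_sub_le_abs_norm_sub_norm_add_min {V : Type*} [SeminormedAddCommGroup V] (x a : V) :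
    ‖x - a‖ ≤ |‖x‖ - ‖a‖| + min (2 * ‖a‖) ‖x - a‖ := by
  rcases min_choice (2 * ‖a‖) ‖x - a‖ with h | h <;> rw [h]
  · linarith [norm_sub_le x a, le_abs_self (‖x‖ - ‖a‖)]
  · linarith [abs_nonneg (‖x‖ - ‖a‖)]

variable [Fact (1 ≤ p)]

theorem tendsto_of_forall_tendsto_of_norm_le (hp : p ≠ ∞) {α : Type*} {l : Filter α}
    {x : α → lp E p} {b : lp (fun _ : ι => ℝ) p} (hb : ∀ᶠ k in l, ∀ i, ‖x k i‖ ≤ b i)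
    (hx : ∀ i, Tendsto (fun k => x k i) l (𝓝 0)) : Tendsto x l (𝓝 0) := by
  have hp0 : 0 < p.toReal := ENNReal.toReal_pos (zero_lt_one.trans_le Fact.out).ne' hp
  have hpow : Tendsto (fun k => ‖x k‖ ^ p.toReal) l (𝓝 (∑' _ : ι, 0)) := by
    simp only [lp.norm_rpow_eq_tsum hp0]
    refine tendsto_tsum_of_dominated_convergence ((lp.memℓp b).summable hp0) (fun i => ?_) ?_
    · simpa [Real.zero_rpow hp0.ne'] using (hx i).norm.rpow_const (Or.inr hp0.le)
    · filter_upwards [hb] with k hk i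
      rw [Real.norm_of_nonneg (by positivity)]
      gcongr
      exact (hk i).trans (le_abs_self _)
  rw [tendsto_zero_iff_norm_tendsto_zero]
  have hroot := hpow.rpow_const (p := p.toReal⁻¹) (Or.inr (by positivity))
  simpa [Real.rpow_rpow_inv (norm_nonneg _) hp0.ne', Real.zero_rpow (inv_pos.2 hp0).ne'] using hroot

theorem tendsto_of_tendsto_coordNorm (hp : p ≠ ∞) {α : Type*} {l : Filter α} {x : α → lp E p}
    {a : lp E p} (hnorm : Tendsto (fun k => coordNorm (x k)) l (𝓝 (coordNorm a)))
    (hcoord : ∀ i, Tendsto (fun k => x k i) l (𝓝 (a i))) : Tendsto x l (𝓝 a) := by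
  have hp0 : p ≠ 0 := (zero_lt_one.trans_le Fact.out).ne'
  have hmin (k : α) : Memℓp (fun i => min (2 * ‖a i‖) ‖x k i - a i‖) p :=
    (lp.memℓp (x k - a)).norm.mono fun i => by
      rw [Real.norm_of_nonneg (by positivity)]
      exact min_le_right _ _
  let m (k : α) : lp (fun _ : ι => ℝ) p := ⟨_, hmin k⟩
  have hm : Tendsto m l (𝓝 0) := by
    refine tendsto_of_forall_tendsto_of_norm_le hp (b := (2 : ℝ) • coordNorm a)
      (Eventually.of_forall fun k i => ?_) fun i => ?_
    · rw [Real.norm_of_nonneg (le_min (by positivity) (norm_nonneg _))]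
      exact min_le_left _ _
    · have := ((hcoord i).sub_const (a i)).norm
      rw [sub_self, norm_zero] at this
      simpa [m] using (tendsto_const_nhds (x := 2 * ‖a i‖)).min this
  have hle (k : α) : ‖x k - a‖ ≤ ‖coordNorm (x k) - coordNorm a‖ + ‖m k‖ := by
    rw [← norm_coordNorm hp0 (coordNorm (x k) - coordNorm a)]
    refine (lp.norm_mono hp0 fun i => ?_).trans (norm_add_le _ (m k))
    exact (norm_sub_le_abs_norm_sub_norm_add_min (x k i) (a i)).trans (le_abs_self _)
  refine tendsto_iff_norm_sub_tendsto_zero.2 (squeeze_zero (fun _ => norm_nonneg _) hle ?_)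
  simpa using (tendsto_iff_norm_sub_tendsto_zero.1 hnorm).add hm.norm

theorem isProperMap_coordNorm [∀ i, ProperSpace (E i)] (hp : p ≠ ∞) :
    IsProperMap (coordNorm : lp E p → lp (fun _ : ι => ℝ) p) := by
  refine isProperMap_iff_ultrafilter_of_t2.2 ⟨lipschitzWith_coordNorm.continuous, fun 𝒰 y hy => ?_⟩
  have hcoord (i : ι) : Tendsto (fun x : lp E p => ‖x i‖) 𝒰 (𝓝 (y i)) :=
    ((lp.lipschitzWith_one_eval p i).continuous.tendsto y).comp hy
  have hlim (i : ι) : ∃ a, Tendsto (fun x : lp E p => x i) 𝒰 (𝓝 a) := by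
    have hball : ∀ᶠ x : lp E p in 𝒰, x i ∈ Metric.closedBall 0 (y i + 1) := by
      filter_upwards [(hcoord i).eventually (Iio_mem_nhds (lt_add_one (y i)))] with x hx
      exact mem_closedBall_zero_iff.2 hx.le
    obtain ⟨a, -, ha⟩ := (isCompact_closedBall (0 : E i) (y i + 1)).ultrafilter_le_nhds
      (𝒰.map fun x : lp E p => x i) (le_principal_iff.2 hball)
    exact ⟨a, ha⟩
  choose a ha using hlim
  have hnorm (i : ι) : ‖a i‖ = y i := tendsto_nhds_unique (ha i).norm (hcoord i)
  have hmem : Memℓp a p := .of_norm (by simpa only [hnorm] using lp.memℓp y)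
  have hy' : coordNorm (⟨a, hmem⟩ : lp E p) = y := lp.ext (funext hnorm)
  exact ⟨⟨a, hmem⟩, tendsto_of_tendsto_coordNorm hp (hy'.symm ▸ hy) ha⟩

variable {𝕜 V : Type*} [NontriviallyNormedField 𝕜] [∀ i, NormedSpace 𝕜 (E i)]
  [NormedAddCommGroup V] [NormedSpace 𝕜 V] [CompleteSpace V]

theorem isClosed_setOf_coefficients [∀ i, CompleteSpace (E i)] (φ : ∀ i, V →L[𝕜] E i) {K : NNReal}
    (hφ : ∀ f, ∀ y : lp E p, (∀ i, y i = φ i f) → ‖f‖ ≤ K * ‖y‖) {A : Set V} (hA : IsClosed A) :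
    IsClosed {y : lp E p | ∃ f ∈ A, ∀ i, y i = φ i f} := by
  let S : Set (V × lp E p) := {q | q.1 ∈ A ∧ ∀ i, q.2 i = φ i q.1}
  have heval (i : ι) : Continuous fun y : lp E p => y i :=
    (lp.lipschitzWith_one_eval p i).continuous
  have hS : IsClosed S := by
    simp only [S, ofPred_and, ofPred_forall]
    exact (hA.preimage continuous_fst).inter (isClosed_iInter fun i =>
      isClosed_eq ((heval i).comp continuous_snd) ((φ i).continuous.comp continuous_fst))
  have : CompleteSpace S := hS.completeSpace_coe
  have hsnd : AntilipschitzWith (max K 1) fun q : S => q.1.2 := by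
    refine AntilipschitzWith.of_le_mul_dist fun ⟨⟨f, y⟩, _, hf⟩ ⟨⟨g, z⟩, _, hg⟩ => ?_
    have hfg : ‖f - g‖ ≤ K * ‖y - z‖ := hφ _ _ fun i => by
      rw [map_sub, ← hf i, ← hg i]
      rfl
    simp only [Subtype.dist_eq, dist_eq_norm, NNReal.coe_max, NNReal.coe_one]
    exact max_le (hfg.trans (by gcongr; exact le_max_left _ _))
      (le_mul_of_one_le_left (norm_nonneg _) (le_max_right _ _))
  convert hsnd.isClosed_range (uniformContinuous_snd.comp uniformContinuous_subtype_val) using 1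
  ext y
  simp [S]

theorem isClosed_setOf_norm_coefficients [∀ i, ProperSpace (E i)] (hp : p ≠ ∞)
    (φ : ∀ i, V →L[𝕜] E i) {K : NNReal} (hφ : ∀ f, ∀ y : lp E p, (∀ i, y i = φ i f) → ‖f‖ ≤ K * ‖y‖)
    {A : Set V} (hA : IsClosed A) :
    IsClosed {z : lp (fun _ : ι => ℝ) p | ∃ f ∈ A, ∀ i, z i = ‖φ i f‖} := by
  convert (isProperMap_coordNorm hp).isClosedMap _ (isClosed_setOf_coefficients φ hφ hA) using 1
  ext z
  constructor
  · rintro ⟨f, hf, hz⟩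
    have hmem : Memℓp (fun i => φ i f) p := .of_norm (by simpa only [← hz] using lp.memℓp z)
    exact ⟨⟨_, hmem⟩, ⟨f, hf, fun i => rfl⟩, lp.ext (funext fun i => (hz i).symm)⟩
  · rintro ⟨y, ⟨f, hf, hy⟩, rfl⟩
    exact ⟨f, hf, fun i => congrArg norm (hy i)⟩

end CoordNorm

theorem continuous_ofInjective_symm_of_isClosedMap {X Y : Type*} [TopologicalSpace X]
    [TopologicalSpace Y] {f : X → Y} (hf : IsClosedMap f) (hinj : Function.Injective f) :
    Continuous (Equiv.ofInjective f hinj).symm := by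
  refine continuous_iff_isClosed.2 fun A hA => ?_
  convert (hf A hA).preimage (continuous_subtype_val (p := (· ∈ range f))) using 1
  ext ⟨_, x, rfl⟩
  simp [hinj.eq_iff]

/-! ### Analyticity of band-limited functions along lines -/

section AnalyticOnLines

variable {V F : Type*} [AddCommGroup V] [Module ℝ V] [NormedAddCommGroup F] [NormedSpace ℝ F]

/-- Real-analyticity of `h` along every affine line. This weakening of joint analyticity on a
finite-dimensional space already carries the identity theorems needed for band-limited functions. -/
def AnalyticOnLines (h : V → F) : Prop :=
  ∀ p y : V, AnalyticOnNhd ℝ (fun t : ℝ => h (p + t • y)) univ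

theorem AnalyticOnLines.comp_neg {h : V → F} (hh : AnalyticOnLines h) :
    AnalyticOnLines fun x => h (-x) := fun p y => by
  simpa only [neg_add, ← smul_neg] using hh (-p) (-y)

theorem AnalyticOnLines.eq_zero_or_eq_zero_of_mul_eq_zero {A : Type*} [NormedRing A] [IsDomain A]
    [NormedAlgebra ℝ A] {g h : V → A} (hg : AnalyticOnLines g) (hh : AnalyticOnLines h)
    (hgh : ∀ x, g x * h x = 0) : g = 0 ∨ h = 0 := by
  by_contra! hne
  obtain ⟨⟨p, hp⟩, ⟨q, hq⟩⟩ := hne.imp Function.ne_iff.1 Function.ne_iff.1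
  rcases (hg p (q - p)).eq_zero_or_eq_zero_of_mul_eq_zero (hh p (q - p)) (fun _ _ => hgh _)
    isPreconnected_univ with h0 | h0
  · exact hp (by simpa using h0 0 (mem_univ _))
  · exact hq (by simpa using h0 1 (mem_univ _))

variable {E : Type*} [NormedAddCommGroup E] [NormedSpace ℝ E] [FiniteDimensional ℝ E]
  [MeasurableSpace E] [BorelSpace E]

theorem AnalyticOnLines.eq_zero_of_measure_zeros_ne_zero (μ : Measure E) [μ.IsAddHaarMeasure]
    {h : E → F} (hh : AnalyticOnLines h) (hc : Continuous h) (hZ : μ {x | h x = 0} ≠ 0) :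
    h = 0 := by
  by_contra hne
  obtain ⟨p, hp⟩ := Function.ne_iff.1 hne
  have hmeas : MeasurableSet {q : E × ℝ | h (p + q.2 • q.1) ≠ 0} :=
    (isOpen_ne_fun (by fun_prop) continuous_const).measurableSet
  have hlines : ∀ᵐ x ∂μ, ∀ᵐ t : ℝ, h (p + t • x) ≠ 0 := .of_forall fun x => by
    have hzeros := (hh p x).preimage_zero_mem_codiscrete (x := 0) (by simpa using hp)
    have hae := ae_restrict_le_codiscreteWithin (μ := (volume : Measure ℝ)) .univ hzeros
    rwa [Measure.restrict_univ] at hae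
  obtain ⟨t, ht0, ht⟩ := ((Measure.ae_ne volume (0 : ℝ)).and
    ((Measure.ae_ae_comm hmeas).1 hlines)).exists
  rw [ae_iff] at ht
  simp only [not_not] at ht
  have himage : {x : E | h (p + t • x) = 0} = (t • ·) ⁻¹' ((p + ·) ⁻¹' {x | h x = 0}) := rfl
  rw [himage, Measure.addHaar_preimage_smul _ ht0, measure_preimage_add] at ht
  exact hZ (by simpa [ht0] using ht)

end AnalyticOnLines

section FourierAnalytic

variable {F : Type*} [NormedAddCommGroup F] [NormedSpace ℂ F]

theorem differentiable_integral_cexp_mul_smul {α : Type*} [MeasurableSpace α] {μ : Measure α}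
    {a : α → ℂ} {g : α → F} {K : ℝ} (ha : AEStronglyMeasurable a μ) (hK : ∀ᵐ x ∂μ, ‖a x‖ ≤ K)
    (hg : Integrable g μ) : Differentiable ℂ fun z : ℂ => ∫ x, Complex.exp (z * a x) • g x ∂μ := by
  intro z₀
  have hmeas (z : ℂ) : AEStronglyMeasurable (fun x => Complex.exp (z * a x) • g x) μ :=
    (Complex.continuous_exp.comp_aestronglyMeasurable (ha.const_mul z)).smul hg.aestronglyMeasurable
  have hbound (z : ℂ) (x : α) (hx : ‖a x‖ ≤ K) :
      ‖Complex.exp (z * a x) • g x‖ ≤ Real.exp (‖z‖ * K) * ‖g x‖ := by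
    rw [norm_smul]
    gcongr
    refine (Complex.norm_exp_le_exp_norm _).trans (Real.exp_le_exp.2 ?_)
    rw [norm_mul]
    gcongr
  refine (hasDerivAt_integral_of_dominated_loc_of_deriv_le (μ := μ)
    (F' := fun z x => a x • Complex.exp (z * a x) • g x)
    (bound := fun x => K * (Real.exp ((‖z₀‖ + 1) * K) * ‖g x‖))
    (Metric.ball_mem_nhds z₀ one_pos) (.of_forall hmeas) ?_ (ha.smul (hmeas z₀)) ?_
    ((hg.norm.const_mul _).const_mul K) ?_).2.differentiableAt
  · refine (hg.norm.const_mul (Real.exp (‖z₀‖ * K))).mono' (hmeas z₀) ?_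
    filter_upwards [hK] with x hx using hbound z₀ x hx
  · filter_upwards [hK] with x hx z hz
    have hK0 : 0 ≤ K := (norm_nonneg _).trans hx
    have hz' : ‖z‖ ≤ ‖z₀‖ + 1 := by
      linarith [norm_le_norm_add_norm_sub' z z₀, mem_ball_iff_norm.1 hz]
    rw [norm_smul]
    gcongr
    exact (hbound z x hx).trans (by gcongr)
  · filter_upwards with x z _
    rw [← mul_smul, mul_comm]
    simpa using (((hasDerivAt_id z).mul_const (a x)).cexp).smul_const (g x)

variable [CompleteSpace F] {E : Type*} [NormedAddCommGroup E] [InnerProductSpace ℝ E]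
  [FiniteDimensional ℝ E] [MeasurableSpace E] [BorelSpace E]

theorem analyticOnLines_fourier {G : E → F} (hG : Integrable G) {S : Set E}
    (hS : Bornology.IsBounded S) (hGS : Function.support G ≤ᵐ[volume] S) :
    AnalyticOnLines (𝓕 G) := by
  intro p y
  obtain ⟨R, hR⟩ := hS.subset_closedBall 0
  let B : Set E := Metric.closedBall 0 R
  let phase (w ξ : E) : ℂ := ((-2 * Real.pi * inner ℝ ξ w : ℝ) : ℂ) * Complex.I
  have hcont (w : E) : Continuous (phase w) := by fun_prop
  have hbound : ∀ᵐ ξ ∂volume.restrict B, ‖phase y ξ‖ ≤ 2 * Real.pi * (R * ‖y‖) := by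
    filter_upwards [ae_restrict_mem Metric.isClosed_closedBall.measurableSet] with ξ hξ
    have hinner : |inner ℝ ξ y| ≤ R * ‖y‖ :=
      (abs_real_inner_le_norm ξ y).trans (by gcongr; exact mem_closedBall_zero_iff.1 hξ)
    simp only [phase, norm_mul, Complex.norm_I, mul_one, Complex.norm_real, Real.norm_eq_abs,
      abs_neg, abs_two, abs_of_pos Real.pi_pos]
    gcongr
  have hint : Integrable (fun ξ => Complex.exp (phase p ξ) • G ξ) (volume.restrict B) := by
    refine hG.restrict.mono ((Complex.continuous_exp.comp (hcont p)).aestronglyMeasurable.smul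
      hG.restrict.aestronglyMeasurable) (.of_forall fun ξ => ?_)
    rw [norm_smul, Complex.norm_exp_ofReal_mul_I, one_mul]
  have hentire := differentiable_integral_cexp_mul_smul (hcont y).aestronglyMeasurable hbound hint
  have hline (t : ℝ) : 𝓕 G (p + t • y) = ∫ ξ in B, Complex.exp (t * phase y ξ) •
      Complex.exp (phase p ξ) • G ξ := by
    rw [Real.fourier_eq', ← setIntegral_eq_integral_of_ae_compl_eq_zero (s := B)]
    · refine integral_congr_ae (.of_forall fun ξ => ?_)
      simp only [phase, ← mul_smul, ← Complex.exp_add, inner_add_right, inner_smul_right]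
      congr 2
      push_cast
      ring
    · filter_upwards [hGS] with ξ hξ hξB
      rw [Function.notMem_support.1 fun h => hξB (hR (hξ h)), smul_zero]
  simp only [hline]
  exact fun t _ => ((hentire.analyticAt _).restrictScalars (𝕜 := ℝ)).comp
    (Complex.ofRealCLM.analyticAt t)

theorem analyticOnLines_fourierInv {G : E → F} (hG : Integrable G) {S : Set E}
    (hS : Bornology.IsBounded S) (hGS : Function.support G ≤ᵐ[volume] S) :
    AnalyticOnLines (𝓕⁻ G) := by
  simpa only [← Real.fourierInv_eq_fourier_neg, neg_neg] using
    (analyticOnLines_fourier hG hS hGS).comp_neg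

end FourierAnalytic

/-! ### The Fourier transform on `L¹ ∩ L²` -/

section Fourier

theorem eLpNorm_two_sq {α F : Type*} [MeasurableSpace α] {μ : Measure α} [NormedAddCommGroup F]
    {f : α → F} (hf : MemLp f 2 μ) :
    eLpNorm f 2 μ ^ 2 = ENNReal.ofReal (∫ x, ‖f x‖ ^ 2 ∂μ) := by
  rw [hf.eLpNorm_eq_integral_rpow_norm two_ne_zero ENNReal.ofNat_ne_top,
    ← ENNReal.ofReal_pow (by positivity)]
  simp only [ENNReal.toReal_ofNat, Real.rpow_ofNat]
  rw [← Real.rpow_natCast, Nat.cast_ofNat, Real.rpow_inv_rpow (by positivity) two_ne_zero]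

variable {E : Type*} [NormedAddCommGroup E] [InnerProductSpace ℝ E] [FiniteDimensional ℝ E]
  [MeasurableSpace E] [BorelSpace E] {F : Type*} [NormedAddCommGroup F]

theorem continuous_fourier [NormedSpace ℂ F] {G : E → F} (hG : Integrable G) :
    Continuous (𝓕 G) :=
  VectorFourier.fourierIntegral_continuous Real.continuous_fourierChar continuous_inner hG

theorem continuous_fourierInv [NormedSpace ℂ F] {G : E → F} (hG : Integrable G) :
    Continuous (𝓕⁻ G) := by
  rw [funext (Real.fourierInv_eq_fourier_neg G)]
  exact (continuous_fourier hG).comp continuous_neg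

theorem integral_fourierInv_smul_eq_flip [NormedSpace ℂ F] [CompleteSpace F] {f : E → ℂ}
    {g : E → F} (hf : Integrable f) (hg : Integrable g) :
    ∫ ξ, 𝓕⁻ f ξ • g ξ = ∫ x, f x • 𝓕⁻ g x := by
  have hflip : (-innerₗ E).flip = -innerₗ E := by
    ext x y
    simp [real_inner_comm]
  have h := VectorFourier.integral_fourierIntegral_smul_eq_flip (L := -innerₗ E) (μ := volume)
    (ν := volume) Real.continuous_fourierChar
    (continuous_inner.neg : Continuous fun p : E × E => -inner ℝ p.1 p.2) hf hg
  rwa [hflip] at h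

variable [InnerProductSpace ℂ F] [CompleteSpace F] {G : E → F}

/-- Both sides have the same inverse Fourier transform as tempered distributions. -/
theorem coeFn_fourierInv_toLp (hG : Integrable G) (hG2 : MemLp G 2) :
    (𝓕⁻ (hG2.toLp G) : Lp F 2 (volume : Measure E)) =ᵐ[volume] 𝓕⁻ G := by
  refine ae_eq_of_integral_contDiff_smul_eq ((Lp.memLp _).locallyIntegrable (by norm_num))
    (continuous_fourierInv hG).locallyIntegrable fun g hg hgc => ?_
  have hsupp : HasCompactSupport (Complex.ofRealCLM ∘ g) := hgc.comp_left rfl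
  let φ : SchwartzMap E ℂ := hsupp.toSchwartzMap (by fun_prop)
  have hφ (x : E) (v : F) : g x • v = φ x • v := (Complex.coe_smul (g x) v).symm
  have hdual := congrArg (· φ) (Lp.fourierInv_toTemperedDistribution_eq (hG2.toLp G))
  simp only [TemperedDistribution.fourierInv_apply, Lp.toTemperedDistribution_apply] at hdual
  calc ∫ x, g x • (𝓕⁻ (hG2.toLp G) : Lp F 2 (volume : Measure E)) x
      = ∫ x, (𝓕⁻ φ) x • (hG2.toLp G) x := by simp only [hφ, hdual]
    _ = ∫ x, 𝓕⁻ (φ : E → ℂ) x • G x := by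
        refine integral_congr_ae ?_
        filter_upwards [hG2.coeFn_toLp] with x hx
        rw [hx, SchwartzMap.fourierInv_coe]
    _ = ∫ x, g x • 𝓕⁻ G x := by
        simp only [integral_fourierInv_smul_eq_flip φ.integrable hG, hφ]

theorem eLpNorm_fourierInv (hG : Integrable G) (hG2 : MemLp G 2) :
    eLpNorm (𝓕⁻ G) 2 volume = eLpNorm G 2 volume := by
  have h : ‖(𝓕⁻ (hG2.toLp G) : Lp F 2 (volume : Measure E))‖ₑ = ‖hG2.toLp G‖ₑ :=
    (Lp.fourierTransformₗᵢ E F).symm.enorm_map _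
  rwa [Lp.enorm_def, Lp.enorm_def, eLpNorm_congr_ae (coeFn_fourierInv_toLp hG hG2),
    eLpNorm_congr_ae hG2.coeFn_toLp] at h

theorem memLp_fourierInv (hG : Integrable G) (hG2 : MemLp G 2) : MemLp (𝓕⁻ G) 2 :=
  ⟨(continuous_fourierInv hG).aestronglyMeasurable, by
    rw [eLpNorm_fourierInv hG hG2]
    exact hG2.2⟩

theorem integral_norm_sq_fourierInv (hG : Integrable G) (hG2 : MemLp G 2) :
    ∫ x, ‖𝓕⁻ G x‖ ^ 2 = ∫ ξ, ‖G ξ‖ ^ 2 := by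
  have h := congrArg (· ^ 2) (eLpNorm_fourierInv hG hG2)
  simp only [eLpNorm_two_sq (memLp_fourierInv hG hG2), eLpNorm_two_sq hG2] at h
  exact (ENNReal.ofReal_eq_ofReal_iff (by positivity) (by positivity)).1 h

theorem ae_eq_zero_of_fourierInv_eq_zero (hG : Integrable G) (hG2 : MemLp G 2) (h : 𝓕⁻ G = 0) :
    G =ᵐ[volume] 0 := by
  rw [← eLpNorm_eq_zero_iff hG.aestronglyMeasurable two_ne_zero, ← eLpNorm_fourierInv hG hG2, h,
    eLpNorm_zero]

theorem ae_eq_zero_of_fourier_eq_zero (hG : Integrable G) (hG2 : MemLp G 2) (h : 𝓕 G = 0) :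
    G =ᵐ[volume] 0 :=
  ae_eq_zero_of_fourierInv_eq_zero hG hG2 <| funext fun x => by
    rw [Real.fourierInv_eq_fourier_neg, h, Pi.zero_apply, Pi.zero_apply]

end Fourier

/-! ### Sampling of band-limited functions -/

section Sampling

variable {d : ℕ}

attribute [local instance] instMeasureSpaceUnitAddCircle in
theorem hasSum_sq_setIntegral_mFourier {ι : Type*} [Fintype ι] (a : ι → ℝ) {g : (ι → ℝ) → ℂ}
    (hg : MemLp g 2 (volume.restrict {x | ∀ i, x i ∈ Ioc (a i) (a i + 1)})) :
    HasSum (fun n : ι → ℤ => ‖∫ x in {x | ∀ i, x i ∈ Ioc (a i) (a i + 1)},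
        UnitAddTorus.mFourier (-n) (fun i => (x i : UnitAddCircle)) • g x‖ ^ 2)
      (∫ x in {x | ∀ i, x i ∈ Ioc (a i) (a i + 1)}, ‖g x‖ ^ 2) := by
  set S : Set (ι → ℝ) := {x | ∀ i, x i ∈ Ioc (a i) (a i + 1)}
  have hSm : MeasurableSet S := MeasurableSet.univ_pi' fun i => measurableSet_Ioc
  let τ : UnitAddTorus ι → ℂ := fun t => g (UnitAddTorus.measurableEquivPiIoc a t)
  have hτ : ∀ x ∈ S, τ (fun i => (x i : UnitAddCircle)) = g x := fun x hx => by
    simp only [τ, UnitAddTorus.coe_measurableEquivPiIoc_apply, AddCircle.equivIoc_coe_eq (hx _)]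
  have hτL : MemLp τ 2 := hg.comp_measurePreserving
    ((measurePreserving_subtype_coe hSm).comp (UnitAddTorus.measurePreserving_equivPiIoc a))
  have hcoeff (n : ι → ℤ) : UnitAddTorus.mFourierCoeff (hτL.toLp τ) n =
      ∫ x in S, UnitAddTorus.mFourier (-n) (fun i => (x i : UnitAddCircle)) • g x := by
    rw [← setIntegral_congr_fun hSm fun x hx => congrArg (_ • ·) (hτ x hx),
      ← UnitAddTorus.mFourierCoeff_eq_integral]
    refine integral_congr_ae ?_
    filter_upwards [hτL.coeFn_toLp] with t ht
    rw [ht]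
  have hnorm : ∫ t, ‖hτL.toLp τ t‖ ^ 2 = ∫ x in S, ‖g x‖ ^ 2 := by
    rw [← setIntegral_congr_fun hSm fun x hx => congrArg (‖·‖ ^ 2) (hτ x hx),
      ← UnitAddTorus.integral_preimage (fun t => ‖τ t‖ ^ 2) a]
    refine integral_congr_ae ?_
    filter_upwards [hτL.coeFn_toLp] with t ht
    rw [ht]
  simpa only [hcoeff, hnorm] using UnitAddTorus.hasSum_sq_mFourierCoeff (hτL.toLp τ)

theorem mFourier_coe_apply {ι : Type*} [Fintype ι] (n : ι → ℤ) (x : ι → ℝ) :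
    UnitAddTorus.mFourier n (fun i => (x i : UnitAddCircle)) =
      Complex.exp (((2 * Real.pi * ∑ i, (n i : ℝ) * x i : ℝ) : ℂ) * Complex.I) := by
  simp only [UnitAddTorus.mFourier, ContinuousMap.coe_mk, fourier_coe_apply, ← Complex.exp_sum]
  push_cast
  rw [Finset.mul_sum, Finset.sum_mul]
  exact congrArg _ (Finset.sum_congr rfl fun i _ => by ring)

theorem preimage_toLp_cube : WithLp.toLp 2 ⁻¹' cube d =
    Icc (fun _ : Fin d => (-(1 / 2) : ℝ)) (fun _ => -(1 / 2) + 1) := by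
  ext x
  have : (-(1 / 2) + 1 : ℝ) = 1 / 2 := by norm_num
  simp only [cube, mem_preimage, mem_ofPred_eq, mem_Icc, Pi.le_def, this, abs_le, forall_and]

theorem ae_eq_preimage_cube : {x : Fin d → ℝ | ∀ i, x i ∈ Ioc (-(1 / 2) : ℝ) (-(1 / 2) + 1)}
    =ᵐ[volume] WithLp.toLp 2 ⁻¹' cube d := by
  have hIoc : {x : Fin d → ℝ | ∀ i, x i ∈ Ioc (-(1 / 2) : ℝ) (-(1 / 2) + 1)} =
      univ.pi fun _ => Ioc (-(1 / 2) : ℝ) (-(1 / 2) + 1) := by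
    ext
    simp only [mem_ofPred_eq, mem_univ_pi]
  rw [hIoc, preimage_toLp_cube]
  exact Measure.univ_pi_Ioc_ae_eq_Icc

theorem volume_cube : volume (cube d) = 1 := by
  rw [← (PiLp.volume_preserving_toLp (Fin d)).measure_preimage_emb
    (MeasurableEquiv.toLp 2 (Fin d → ℝ)).measurableEmbedding, preimage_toLp_cube,
    Real.volume_Icc_pi]
  simp only [add_sub_cancel_left, ENNReal.ofReal_one, Finset.prod_const_one]

theorem hasSum_sq_fourierInv_cube {g : EuclideanSpace ℝ (Fin d) → ℂ} (hg : MemLp g 2)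
    (hgS : Function.support g ≤ᵐ[volume] cube d) :
    HasSum (fun n : Fin d → ℤ => ‖𝓕⁻ g (WithLp.toLp 2 fun i => (n i : ℝ))‖ ^ 2)
      (∫ ξ, ‖g ξ‖ ^ 2) := by
  have hvol := PiLp.volume_preserving_toLp (Fin d)
  have hemb := (MeasurableEquiv.toLp 2 (Fin d → ℝ)).measurableEmbedding
  have hout : ∀ᵐ x : Fin d → ℝ, x ∉ {x | ∀ i, x i ∈ Ioc (-(1 / 2) : ℝ) (-(1 / 2) + 1)} →
      g (WithLp.toLp 2 x) = 0 := by
    filter_upwards [hvol.quasiMeasurePreserving.ae hgS, ae_eq_preimage_cube.mem_iff]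
      with x hx hcube hxS
    exact Function.notMem_support.1 fun h => hxS (hcube.2 (hx h))
  have hsum := hasSum_sq_setIntegral_mFourier (fun _ => -(1 / 2))
    ((hg.comp_measurePreserving hvol).restrict _)
  simp only [Function.comp_apply] at hsum
  rw [setIntegral_eq_integral_of_ae_compl_eq_zero (by
      filter_upwards [hout] with x hx hxS using by rw [hx hxS, norm_zero, zero_pow two_ne_zero]),
    hvol.integral_comp hemb (fun ξ => ‖g ξ‖ ^ 2), ← (Equiv.neg _).hasSum_iff] at hsum
  refine hsum.congr_fun fun n => ?_
  rw [Function.comp_apply, setIntegral_eq_integral_of_ae_compl_eq_zero (by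
      filter_upwards [hout] with x hx hxS using by rw [hx hxS, smul_zero]),
    Real.fourierInv_eq', ← hvol.integral_comp hemb]
  simp only [Equiv.neg_apply, neg_neg, mFourier_coe_apply]
  rfl

section LinearMap

variable {E : Type*} [NormedAddCommGroup E] [InnerProductSpace ℝ E] [FiniteDimensional ℝ E]
  [MeasurableSpace E] [BorelSpace E] {F : Type*} [NormedAddCommGroup F] {L : E →ₗ[ℝ] E}

theorem measurableEmbedding_of_det_ne_zero (hL : L.det ≠ 0) : MeasurableEmbedding L :=
  L.continuous_of_finiteDimensional.measurableEmbedding (LinearMap.equivOfDetNeZero L hL).injective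

theorem integral_comp_linearMap [NormedSpace ℝ F] (hL : L.det ≠ 0) (G : E → F) :
    ∫ η, G (L η) = |L.det|⁻¹ • ∫ ξ, G ξ := by
  rw [← (measurableEmbedding_of_det_ne_zero hL).integral_map,
    Measure.map_linearMap_addHaar_eq_smul_addHaar _ hL, integral_smul_measure,
    ENNReal.toReal_ofReal (abs_nonneg _), abs_inv]

theorem memLp_comp_linearMap (hL : L.det ≠ 0) {G : E → F} {p : ℝ≥0∞} (hG : MemLp G p) :
    MemLp (fun η => G (L η)) p := by
  refine MemLp.comp_of_map (f := L) (g := G) ?_ L.continuous_of_finiteDimensional.aemeasurable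
  rw [Measure.map_linearMap_addHaar_eq_smul_addHaar _ hL]
  exact hG.smul_measure ENNReal.ofReal_ne_top

theorem fourierInv_comp_linearMap [NormedSpace ℂ F] (hL : L.det ≠ 0) (G : E → F) (w : E) :
    𝓕⁻ (fun η => G (L η)) (L.adjoint w) = |L.det|⁻¹ • 𝓕⁻ G w := by
  simp only [Real.fourierInv_eq', LinearMap.adjoint_inner_right]
  exact integral_comp_linearMap hL
    fun ξ => Complex.exp (((2 * Real.pi * inner ℝ ξ w : ℝ) : ℂ) * Complex.I) • G ξ

end LinearMap

/-- Parseval; by `hx` the points `x n` form the lattice dual to `L ℤᵈ`. -/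
theorem hasSum_sq_fourierInv_lattice
    {L : EuclideanSpace ℝ (Fin d) →ₗ[ℝ] EuclideanSpace ℝ (Fin d)} (hL : L.det ≠ 0)
    {x : (Fin d → ℤ) → EuclideanSpace ℝ (Fin d)}
    (hx : ∀ n, L.adjoint (x n) = WithLp.toLp 2 fun i => (n i : ℝ))
    {G : EuclideanSpace ℝ (Fin d) → ℂ} (hG : MemLp G 2)
    (hGS : Function.support G ≤ᵐ[volume] L '' cube d) :
    HasSum (fun n => ‖𝓕⁻ G (x n)‖ ^ 2) (|L.det| * ∫ ξ, ‖G ξ‖ ^ 2) := by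
  have hsupp : Function.support (fun η => G (L η)) ≤ᵐ[volume] cube d := by
    filter_upwards [(Measure.LinearMap.quasiMeasurePreserving volume L hL).ae hGS] with η hη hne
    exact (measurableEmbedding_of_det_ne_zero hL).injective.mem_set_image.1 (hη hne)
  have hdet : |L.det| ≠ 0 := abs_ne_zero.2 hL
  have h := (hasSum_sq_fourierInv_cube (memLp_comp_linearMap hL hG) hsupp).mul_left (|L.det| ^ 2)
  have hsum : |L.det| ^ 2 * (|L.det|⁻¹ * ∫ ξ, ‖G ξ‖ ^ 2) = |L.det| * ∫ ξ, ‖G ξ‖ ^ 2 := by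
    field_simp
  rw [integral_comp_linearMap hL fun ξ => ‖G ξ‖ ^ 2, smul_eq_mul, hsum] at h
  simpa only [← hx, fourierInv_comp_linearMap hL, norm_smul, norm_inv, Real.norm_eq_abs, abs_abs,
    mul_pow, inv_pow, mul_inv_cancel_left₀ (pow_ne_zero 2 hdet)] using h

end Sampling

/-! ### Products of band-limited functions -/

theorem indicator_ae_eq_of_support_le {α M : Type*} [MeasurableSpace α] {μ : Measure α} [Zero M]
    {f : α → M} {S : Set α} (hf : Function.support f ≤ᵐ[μ] S) : S.indicator f =ᵐ[μ] f := by
  filter_upwards [hf] with x hx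
  exact indicator_apply_eq_self.2 fun h => Function.notMem_support.1 fun h' => h (hx h')

section Product

open scoped Convolution Pointwise

variable {E : Type*} [NormedAddCommGroup E] [InnerProductSpace ℝ E] [FiniteDimensional ℝ E]
  [MeasurableSpace E] [BorelSpace E] {P Q : E → ℂ}

theorem fourierInv_mul_convolution (hP : Integrable P) (hQ : Integrable Q) (x : E) :
    𝓕⁻ (P ⋆[ContinuousLinearMap.mul ℂ ℂ] Q) x = 𝓕⁻ P x * 𝓕⁻ Q x := by
  simp only [Real.fourierInv_eq_fourier_neg]
  exact Real.fourier_mul_convolution_eq hP hQ (-x)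

theorem enorm_mul_convolution_le (hP : MemLp P 2) (hQ : MemLp Q 2) (x : E) :
    ‖(P ⋆[ContinuousLinearMap.mul ℂ ℂ] Q) x‖ₑ ≤ eLpNorm P 2 volume * eLpNorm Q 2 volume := by
  have hrefl := Measure.measurePreserving_sub_left (volume : Measure E) x
  calc ‖(P ⋆[ContinuousLinearMap.mul ℂ ℂ] Q) x‖ₑ
      ≤ eLpNorm (P • fun t => Q (x - t)) 1 volume := by
        rw [eLpNorm_one_eq_lintegral_enorm]
        exact enorm_integral_le_lintegral_enorm _
    _ ≤ eLpNorm P 2 volume * eLpNorm (Q ∘ (x - ·)) 2 volume :=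
        eLpNorm_smul_le_mul_eLpNorm (hQ.comp_measurePreserving hrefl).1 hP.1
    _ = eLpNorm P 2 volume * eLpNorm Q 2 volume := by
        rw [eLpNorm_comp_measurePreserving hQ.1 hrefl]

theorem memLp_two_mul_convolution (hP : Integrable P) (hQ : Integrable Q) (hP2 : MemLp P 2)
    (hQ2 : MemLp Q 2) : MemLp (P ⋆[ContinuousLinearMap.mul ℂ ℂ] Q) 2 := by
  have hint := hP.integrable_convolution (ContinuousLinearMap.mul ℂ ℂ) hQ
  have hbound (x : E) := (ENNReal.toReal_le_toReal enorm_ne_top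
    (ENNReal.mul_ne_top hP2.2.ne hQ2.2.ne)).2 (enorm_mul_convolution_le hP2 hQ2 x)
  rw [memLp_two_iff_integrable_sq_norm hint.1]
  simp only [sq]
  exact hint.norm.bdd_mul hint.1.norm (.of_forall fun x => (norm_norm _).trans_le (hbound x))

theorem exists_fourierInv_eq_mul (hP : Integrable P) (hQ : Integrable Q) (hP2 : MemLp P 2)
    (hQ2 : MemLp Q 2) {S T : Set E} (hPS : Function.support P ≤ᵐ[volume] S)
    (hQT : Function.support Q ≤ᵐ[volume] T) :
    ∃ H : E → ℂ, MemLp H 2 ∧ Function.support H ⊆ S + T ∧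
      ∀ x, 𝓕⁻ H x = 𝓕⁻ P x * 𝓕⁻ Q x := by
  have hP' := indicator_ae_eq_of_support_le hPS
  have hQ' := indicator_ae_eq_of_support_le hQT
  have hPi := hP.congr hP'.symm
  have hQi := hQ.congr hQ'.symm
  refine ⟨S.indicator P ⋆[ContinuousLinearMap.mul ℂ ℂ] T.indicator Q,
    memLp_two_mul_convolution hPi hQi (hP2.ae_eq hP'.symm) (hQ2.ae_eq hQ'.symm), ?_, fun x => ?_⟩
  · exact (support_convolution_subset _).trans
      (add_subset_add support_indicator_subset support_indicator_subset)
  · rw [fourierInv_mul_convolution hPi hQi, Real.fourierInv_congr_ae hP',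
      Real.fourierInv_congr_ae hQ']

end Product

/-! ### Sign-blind sampling sets -/

section SignBlind

open scoped Pointwise

variable {d : ℕ} {F : Set (EuclideanSpace ℝ (Fin d))} {M : Matrix (Fin d) (Fin d) ℝ}
  {s : Fin d → ℝ}

/-- The linear map `M D[2s]`: the sampling set `(Mᵀ)⁻¹ D[2s]⁻¹ ℤᵈ` is the lattice dual to the
image of `ℤᵈ` under it. -/
noncomputable def dualLatticeMap (M : Matrix (Fin d) (Fin d) ℝ) (s : Fin d → ℝ) :
    EuclideanSpace ℝ (Fin d) →ₗ[ℝ] EuclideanSpace ℝ (Fin d) :=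
  Matrix.toEuclideanLin (M * Matrix.diagonal fun i => 2 * s i)

theorem det_dualLatticeMap (M : Matrix (Fin d) (Fin d) ℝ) (s : Fin d → ℝ) :
    (dualLatticeMap M s).det = M.det * (2 ^ d * ∏ i, s i) := by
  rw [dualLatticeMap, LinearMap.det_toLpLin, Matrix.det_mul, Matrix.det_diagonal,
    Finset.prod_mul_distrib, Finset.prod_const, Finset.card_univ, Fintype.card_fin]

theorem adjoint_dualLatticeMap_latticePoint (h : (dualLatticeMap M s).det ≠ 0) (n : Fin d → ℤ) :
    (dualLatticeMap M s).adjoint (latticePoint M s n) = WithLp.toLp 2 fun i => (n i : ℝ) := by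
  set N := M * Matrix.diagonal fun i => 2 * s i with hN
  have hpoint : latticePoint M s n = WithLp.toLp 2 (N.transpose⁻¹.mulVec fun i => (n i : ℝ)) := by
    rw [latticePoint, hN, Matrix.transpose_mul, Matrix.mul_inv_rev, Matrix.diagonal_transpose,
      Matrix.mulVec_mulVec]
  have hunit : IsUnit N.transpose.det := by
    rw [Matrix.det_transpose]
    exact (by simpa only [dualLatticeMap, LinearMap.det_toLpLin] using h : N.det ≠ 0).isUnit
  rw [dualLatticeMap, ← Matrix.toEuclideanLin_conjTranspose_eq_adjoint,
    Matrix.conjTranspose_eq_transpose_of_trivial, hpoint, Matrix.toLpLin_apply,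
    Matrix.mulVec_mulVec, Matrix.mul_nonsing_inv _ hunit, Matrix.one_mulVec]

theorem toEuclideanLin_mem_image_dualLatticeMap (hs : ∀ i, 1 ≤ s i)
    {x : EuclideanSpace ℝ (Fin d)} (hx : ∀ i, |x i| ≤ 1) :
    Matrix.toEuclideanLin M x ∈ dualLatticeMap M s '' cube d := by
  have hpos (i : Fin d) : 0 < 2 * s i := by linarith [hs i]
  refine ⟨WithLp.toLp 2 fun i => x i / (2 * s i), fun i => ?_, ?_⟩
  · change |x i / (2 * s i)| ≤ 1 / 2
    rw [abs_div, abs_of_pos (hpos i), div_le_div_iff₀ (hpos i) two_pos]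
    linarith [hx i, hs i]
  · simp only [dualLatticeMap, Matrix.toLpLin_apply, ← Matrix.mulVec_mulVec]
    congr 2
    ext i
    rw [Matrix.mulVec_diagonal, mul_div_cancel₀ _ (hpos i).ne']

theorem volume_image_cube (M : Matrix (Fin d) (Fin d) ℝ) :
    volume ((fun x => Matrix.toEuclideanLin M x) '' cube d) = ENNReal.ofReal |M.det| := by
  rw [Measure.addHaar_image_linearMap, volume_cube, mul_one, LinearMap.det_toLpLin]

namespace IsSignBlind

theorem prod_pos (hX : IsSignBlind F M s) : 0 < 2 ^ d * ∏ i, s i :=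
  mul_pos (by positivity) (Finset.prod_pos fun i _ => one_pos.trans_le (hX.one_le i))

theorem det_dualLatticeMap_ne_zero (hX : IsSignBlind F M s) : (dualLatticeMap M s).det ≠ 0 := by
  rw [det_dualLatticeMap]
  exact mul_ne_zero hX.det_ne_zero hX.prod_pos.ne'

theorem subset_image_dualLatticeMap (hX : IsSignBlind F M s) :
    F ⊆ dualLatticeMap M s '' cube d := fun ξ hξ => by
  obtain ⟨x, hx, rfl⟩ := hX.subset hξ
  exact toEuclideanLin_mem_image_dualLatticeMap hX.one_le fun i => (hx i).trans (by norm_num)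

/-- This is where the oversampling by a factor of two in every direction is needed. -/
theorem add_subset_image_dualLatticeMap (hX : IsSignBlind F M s) :
    F + F ⊆ dualLatticeMap M s '' cube d := by
  rintro _ ⟨ξ, hξ, η, hη, rfl⟩
  obtain ⟨x, hx, rfl⟩ := hX.subset hξ
  obtain ⟨y, hy, rfl⟩ := hX.subset hη
  simp only [← map_add]
  refine toEuclideanLin_mem_image_dualLatticeMap hX.one_le fun i => (abs_add_le _ _).trans ?_
  exact (add_le_add (hx i) (hy i)).trans (by norm_num)

theorem hasSum_sq_fourierInv (hX : IsSignBlind F M s) {G : EuclideanSpace ℝ (Fin d) → ℂ}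
    (hG : MemLp G 2) (hGF : Function.support G ≤ᵐ[volume] F) :
    HasSum (fun n => ‖𝓕⁻ G (latticePoint M s n)‖ ^ 2)
      (|M.det| * (2 ^ d * ∏ i, s i) * ∫ ξ, ‖G ξ‖ ^ 2) := by
  have h := hasSum_sq_fourierInv_lattice hX.det_dualLatticeMap_ne_zero
    (adjoint_dualLatticeMap_latticePoint hX.det_dualLatticeMap_ne_zero) hG
    (hGF.trans hX.subset_image_dualLatticeMap.eventuallyLE)
  rwa [det_dualLatticeMap, abs_mul, abs_of_pos hX.prod_pos] at h

/-- The product has its spectrum in `F + F`, so it is itself determined by its samples. -/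
theorem fourierInv_mul_fourierInv_eq_zero (hX : IsSignBlind F M s)
    {P Q : EuclideanSpace ℝ (Fin d) → ℂ} (hP : Integrable P) (hQ : Integrable Q)
    (hP2 : MemLp P 2) (hQ2 : MemLp Q 2) (hPF : Function.support P ≤ᵐ[volume] F)
    (hQF : Function.support Q ≤ᵐ[volume] F)
    (h : ∀ n, 𝓕⁻ P (latticePoint M s n) * 𝓕⁻ Q (latticePoint M s n) = 0)
    (x : EuclideanSpace ℝ (Fin d)) : 𝓕⁻ P x * 𝓕⁻ Q x = 0 := by
  obtain ⟨H, hH2, hHF, hHPQ⟩ := exists_fourierInv_eq_mul hP hQ hP2 hQ2 hPF hQF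
  have hsum := hasSum_sq_fourierInv_lattice hX.det_dualLatticeMap_ne_zero
    (adjoint_dualLatticeMap_latticePoint hX.det_dualLatticeMap_ne_zero) hH2
    (hHF.trans hX.add_subset_image_dualLatticeMap).eventuallyLE
  simp only [hHPQ, h, norm_zero, zero_pow two_ne_zero] at hsum
  have hint := (mul_eq_zero.1 (hsum.unique hasSum_zero)).resolve_left
    (abs_ne_zero.2 hX.det_dualLatticeMap_ne_zero)
  rw [integral_eq_zero_iff_of_nonneg (fun ξ => by positivity)
    (hH2.integrable_norm_pow two_ne_zero)] at hint
  have hH0 : H =ᵐ[volume] 0 := by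
    filter_upwards [hint] with ξ hξ using norm_eq_zero.1 (pow_eq_zero_iff two_ne_zero |>.1 hξ)
  rw [← hHPQ, Real.fourierInv_congr_ae hH0, Real.fourierInv_eq']
  simp only [Pi.zero_apply, smul_zero, integral_zero]

end IsSignBlind

end SignBlind

/-! ### The spectrum of a convolution -/

section Convolution

variable {d : ℕ} {ψ : Lp ℝ 2 (volume : Measure (EuclideanSpace ℝ (Fin d)))}
  {g : EuclideanSpace ℝ (Fin d) → ℂ}

theorem support_ae_le_essSupport (g : Lp ℂ 2 (volume : Measure (EuclideanSpace ℝ (Fin d)))) :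
    Function.support g ≤ᵐ[volume] essSupport g := by
  have hnull : volume (Function.support g \ essSupport g) = 0 := by
    refine measure_null_of_locally_null _ fun ξ hξ => ?_
    have hnot : ¬∀ U ∈ 𝓝 ξ, 0 < volume (U ∩ Function.support g) := hξ.2
    push Not at hnot
    obtain ⟨U, hU, hU0⟩ := hnot
    exact ⟨U ∩ Function.support g,
      inter_mem (mem_nhdsWithin_of_mem_nhds hU) (mem_of_superset self_mem_nhdsWithin sdiff_subset),
      nonpos_iff_eq_zero.1 hU0⟩
  exact ae_le_set.2 hnull

theorem integrable_fourierL2 (hψ : IsCompact (fourierSupport ψ)) : Integrable (fourierL2 ψ) :=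
  memLp_one_iff_integrable.1 <| (Lp.memLp (fourierL2 ψ)).mono_exponent_of_measure_support_ne_top
    (fun _ => Function.notMem_support.1)
    ((measure_mono_ae (support_ae_le_essSupport _)).trans_lt hψ.measure_lt_top).ne one_le_two

theorem ofReal_ae_eq_fourierInv_fourierL2 (hψ : Integrable (fourierL2 ψ)) :
    (fun x => (ψ x : ℂ)) =ᵐ[volume] 𝓕⁻ (fourierL2 ψ : EuclideanSpace ℝ (Fin d) → ℂ) := by
  have hinv : 𝓕⁻ (fourierL2 ψ) = Complex.ofRealCLM.compLp ψ :=
    FourierTransform.fourierInv_fourier_eq _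
  have h := coeFn_fourierInv_toLp hψ (Lp.memLp (fourierL2 ψ))
  rw [Lp.toLp_coeFn, hinv] at h
  filter_upwards [Complex.ofRealCLM.coeFn_compLp ψ, h] with x hx hx'
  rw [← hx', hx, Complex.ofRealCLM_apply]

theorem fourierInv_comp_sub_left {E V : Type*} [NormedAddCommGroup E] [InnerProductSpace ℝ E]
    [FiniteDimensional ℝ E] [MeasurableSpace E] [BorelSpace E] [NormedAddCommGroup V]
    [NormedSpace ℂ V] (g : E → V) (x ξ : E) : 𝓕⁻ (fun t => g (x - t)) ξ =
      Complex.exp (((2 * Real.pi * inner ℝ ξ x : ℝ) : ℂ) * Complex.I) • 𝓕 g ξ := by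
  rw [Real.fourierInv_eq', Real.fourier_eq', ← integral_smul, ← integral_sub_left_eq_self _ _ x]
  refine integral_congr_ae (.of_forall fun t => ?_)
  simp only [sub_sub_cancel, smul_smul, ← Complex.exp_add, inner_sub_left, real_inner_comm x ξ]
  congr 2
  push_cast
  ring

/-- The Fourier transform of `g ∗ ψ`. -/
noncomputable def convSpectrum (g : EuclideanSpace ℝ (Fin d) → ℂ)
    (ψ : Lp ℝ 2 (volume : Measure (EuclideanSpace ℝ (Fin d)))) :
    EuclideanSpace ℝ (Fin d) → ℂ :=
  fun ξ => 𝓕 g ξ * fourierL2 ψ ξ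

theorem conv_eq_fourierInv_convSpectrum (hψ : Integrable (fourierL2 ψ)) (hg : Integrable g) :
    conv g ψ = 𝓕⁻ (convSpectrum g ψ) := funext fun x =>
  calc conv g ψ x = ∫ t, (ψ (x - t) : ℂ) • g t := rfl
    _ = ∫ t, (ψ t : ℂ) • g (x - t) := by
        rw [← integral_sub_left_eq_self _ _ x]
        simp only [sub_sub_cancel]
    _ = ∫ t, 𝓕⁻ (fourierL2 ψ : EuclideanSpace ℝ (Fin d) → ℂ) t • g (x - t) := by
        refine integral_congr_ae ?_
        filter_upwards [ofReal_ae_eq_fourierInv_fourierL2 hψ] with t ht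
        rw [ht]
    _ = ∫ ξ, fourierL2 ψ ξ • 𝓕⁻ (fun t => g (x - t)) ξ :=
        integral_fourierInv_smul_eq_flip hψ (hg.comp_sub_left x)
    _ = 𝓕⁻ (convSpectrum g ψ) x := by
        rw [Real.fourierInv_eq']
        refine integral_congr_ae (.of_forall fun ξ => ?_)
        simp only [fourierInv_comp_sub_left, convSpectrum, smul_eq_mul]
        ring

theorem memLp_convSpectrum {p : ℝ≥0∞} (hψ : MemLp (fourierL2 ψ) p) (hg : Integrable g) :
    MemLp (convSpectrum g ψ) p := by
  refine hψ.of_le_mul ((continuous_fourier hg).aestronglyMeasurable.mul hψ.1) (c := ∫ t, ‖g t‖)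
    (.of_forall fun ξ => ?_)
  rw [convSpectrum, norm_mul]
  exact mul_le_mul_of_nonneg_right
    (VectorFourier.norm_fourierIntegral_le_integral_norm _ _ _ _ _) (norm_nonneg _)

theorem memLp_two_convSpectrum (hg : Integrable g) : MemLp (convSpectrum g ψ) 2 :=
  memLp_convSpectrum (Lp.memLp _) hg

theorem integrable_convSpectrum (hψ : Integrable (fourierL2 ψ)) (hg : Integrable g) :
    Integrable (convSpectrum g ψ) :=
  memLp_one_iff_integrable.1 (memLp_convSpectrum (memLp_one_iff_integrable.2 hψ) hg)

theorem support_convSpectrum_ae_le (g : EuclideanSpace ℝ (Fin d) → ℂ)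
    (ψ : Lp ℝ 2 (volume : Measure (EuclideanSpace ℝ (Fin d)))) :
    Function.support (convSpectrum g ψ) ≤ᵐ[volume] fourierSupport ψ :=
  (Function.support_mul_subset_right _ _).eventuallyLE.trans (support_ae_le_essSupport _)

theorem norm_fourierL2 (ψ : Lp ℝ 2 (volume : Measure (EuclideanSpace ℝ (Fin d)))) :
    ‖fourierL2 ψ‖ = ‖ψ‖ := by
  rw [fourierL2, Lp.norm_fourier_eq, Lp.norm_def, Lp.norm_def]
  congr 1
  refine eLpNorm_congr_norm_ae ?_
  filter_upwards [Complex.ofRealCLM.coeFn_compLp ψ] with x hx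
  rw [hx, Complex.ofRealCLM_apply, Complex.norm_real]

theorem measure_support_fourierL2_eq_zero_iff :
    volume (Function.support (fourierL2 ψ)) = 0 ↔ ψ = 0 := by
  rw [← norm_eq_zero, ← norm_fourierL2, norm_eq_zero, Lp.eq_zero_iff_ae_eq_zero]
  exact Iff.rfl

theorem ne_zero_of_nonempty_fourierSupport (h : (fourierSupport ψ).Nonempty) : ψ ≠ 0 := by
  obtain ⟨ξ, hξ⟩ := h
  refine fun h0 => (hξ univ univ_mem).ne' ?_
  rw [univ_inter]
  exact measure_support_fourierL2_eq_zero_iff.2 h0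

theorem volume_real_fourierSupport_pos (hψ : IsCompact (fourierSupport ψ)) (hψ0 : ψ ≠ 0) :
    0 < volume.real (fourierSupport ψ) :=
  ENNReal.toReal_pos (fun h => hψ0 (measure_support_fourierL2_eq_zero_iff.1
    (measure_mono_null_ae (support_ae_le_essSupport _) h))) hψ.measure_lt_top.ne

/-- An integrable function `g` of compact support has an analytic Fourier transform, while
`ĝ ψ̂ = 0` forces `ĝ` to vanish on the support of `ψ̂`. -/
theorem ae_eq_zero_of_conv_eq_zero (hψ : Integrable (fourierL2 ψ)) (hψ0 : ψ ≠ 0)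
    (hg : Integrable g) (hg2 : MemLp g 2) {S : Set (EuclideanSpace ℝ (Fin d))}
    (hS : Bornology.IsBounded S) (hgS : Function.support g ≤ᵐ[volume] S) (h : conv g ψ = 0) :
    g =ᵐ[volume] 0 := by
  have hspec : convSpectrum g ψ =ᵐ[volume] 0 :=
    ae_eq_zero_of_fourierInv_eq_zero (integrable_convSpectrum hψ hg) (memLp_two_convSpectrum hg)
      (conv_eq_fourierInv_convSpectrum hψ hg ▸ h)
  have hzeros : Function.support (fourierL2 ψ) ≤ᵐ[volume] {ξ | 𝓕 g ξ = 0} := by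
    filter_upwards [hspec] with ξ hξ hne using (mul_eq_zero.1 hξ).resolve_right hne
  refine ae_eq_zero_of_fourier_eq_zero hg hg2 ?_
  refine (analyticOnLines_fourier hg hS hgS).eq_zero_of_measure_zeros_ne_zero volume
    (continuous_fourier hg) ?_
  exact fun h0 => hψ0 (measure_support_fourierL2_eq_zero_iff.1 (measure_mono_null_ae hzeros h0))

end Convolution

/-! ### Convolutions with functions of compact support -/

section ConvOn

variable {d : ℕ} {C : Set (EuclideanSpace ℝ (Fin d))}
  {ψ : Lp ℝ 2 (volume : Measure (EuclideanSpace ℝ (Fin d)))}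

/-- The extension of `f ∈ L²(C, ℝ)` by zero, as a complex-valued function on `ℝᵈ`. -/
noncomputable def extendByZero (f : L2On C) : EuclideanSpace ℝ (Fin d) → ℂ :=
  fun x => (C.indicator f x : ℝ)

theorem memLp_extendByZero (hC : MeasurableSet C) (f : L2On C) : MemLp (extendByZero f) 2 :=
  ((memLp_indicator_iff_restrict hC).2 (Lp.memLp f)).ofReal

theorem support_extendByZero_subset (f : L2On C) : Function.support (extendByZero f) ⊆ C :=
  fun x hx => by
    by_contra hxC
    exact hx (by rw [extendByZero, indicator_of_notMem hxC, Complex.ofReal_zero])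

theorem integrable_extendByZero (hC : IsCompact C) (f : L2On C) : Integrable (extendByZero f) :=
  memLp_one_iff_integrable.1 <|
    (memLp_extendByZero hC.measurableSet f).mono_exponent_of_measure_support_ne_top
      (fun _ => Function.notMem_support.1)
      ((measure_mono (support_extendByZero_subset f)).trans_lt hC.measure_lt_top).ne one_le_two

theorem norm_toLp_extendByZero (hC : MeasurableSet C) (f : L2On C) :
    ‖(memLp_extendByZero hC f).toLp‖ = ‖f‖ := by
  rw [Lp.norm_toLp, Lp.norm_def, ← eLpNorm_indicator_eq_eLpNorm_restrict hC]
  congr 1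
  exact eLpNorm_congr_norm_ae (.of_forall fun x => Complex.norm_real _)

theorem eq_zero_of_extendByZero_ae_eq_zero (hC : MeasurableSet C) {f : L2On C}
    (h : extendByZero f =ᵐ[volume] 0) : f = 0 := by
  rw [← norm_eq_zero, ← norm_toLp_extendByZero hC, norm_eq_zero, Lp.eq_zero_iff_ae_eq_zero]
  exact (memLp_extendByZero hC f).coeFn_toLp.trans h

theorem ofReal_convOn (f : L2On C) (ψ : EuclideanSpace ℝ (Fin d) → ℝ) :
    (fun x => (convOn f ψ x : ℂ)) = conv (extendByZero f) ψ := by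
  ext x
  unfold convOn conv convolution
  rw [← integral_complex_ofReal]
  simp [extendByZero]

theorem memLp_comp_sub_left (ψ : Lp ℝ 2 (volume : Measure (EuclideanSpace ℝ (Fin d))))
    (C : Set (EuclideanSpace ℝ (Fin d))) (x : EuclideanSpace ℝ (Fin d)) :
    MemLp (fun t => ψ (x - t)) 2 (volume.restrict C) :=
  ((Lp.memLp ψ).comp_measurePreserving (Measure.measurePreserving_sub_left volume x)).restrict C

/-- The functional `f ↦ (f ∗ ψ)(x)` on `L²(C, ℝ)`. -/
noncomputable def convFunctional (ψ : Lp ℝ 2 (volume : Measure (EuclideanSpace ℝ (Fin d))))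
    (C : Set (EuclideanSpace ℝ (Fin d))) (x : EuclideanSpace ℝ (Fin d)) : L2On C →L[ℝ] ℝ :=
  innerSL ℝ (memLp_comp_sub_left ψ C x).toLp

theorem convFunctional_apply (hC : MeasurableSet C) (x : EuclideanSpace ℝ (Fin d)) (f : L2On C) :
    convFunctional ψ C x f = convOn f ψ x := by
  have hout (t) (ht : t ∉ C) : ψ (x - t) * C.indicator f t = 0 := by
    rw [indicator_of_notMem ht, mul_zero]
  calc convFunctional ψ C x f = ∫ t in C, ψ (x - t) * C.indicator f t := by
        rw [convFunctional, innerSL_apply_apply, L2.inner_def]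
        refine integral_congr_ae ?_
        filter_upwards [(memLp_comp_sub_left ψ C x).coeFn_toLp, ae_restrict_mem hC] with t ht htC
        rw [ht, indicator_of_mem htC]
        exact mul_comm _ _
    _ = convOn f ψ x := setIntegral_eq_integral_of_forall_compl_eq_zero hout

theorem convOn_sub (hC : MeasurableSet C) (f g : L2On C) (x : EuclideanSpace ℝ (Fin d)) :
    convOn (f - g) ψ x = convOn f ψ x - convOn g ψ x := by
  simp only [← convFunctional_apply hC, map_sub]

theorem convOn_add (hC : MeasurableSet C) (f g : L2On C) (x : EuclideanSpace ℝ (Fin d)) :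
    convOn (f + g) ψ x = convOn f ψ x + convOn g ψ x := by
  simp only [← convFunctional_apply hC, map_add]

theorem eLpNorm_conv_toLp_extendByZero_sq (hψ : Integrable (fourierL2 ψ)) (hC : IsCompact C)
    (f : L2On C) :
    eLpNorm (conv ((memLp_extendByZero hC.measurableSet f).toLp) ψ) 2 volume ^ 2 =
      ENNReal.ofReal (∫ x, convOn f ψ x ^ 2) := by
  have hf := integrable_extendByZero hC f
  have hconv : conv (memLp_extendByZero hC.measurableSet f).toLp ψ = conv (extendByZero f) ψ := by
    ext x
    refine integral_congr_ae ?_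
    filter_upwards [(memLp_extendByZero hC.measurableSet f).coeFn_toLp] with t ht
    rw [ht]
  have hL2 : MemLp (conv (extendByZero f) ψ) 2 := by
    rw [conv_eq_fourierInv_convSpectrum hψ hf]
    exact memLp_fourierInv (integrable_convSpectrum hψ hf) (memLp_two_convSpectrum hf)
  rw [hconv, eLpNorm_two_sq hL2, ← ofReal_convOn]
  simp only [Complex.norm_real, Real.norm_eq_abs, sq_abs]

theorem hasSum_sq_convOn_latticePoint (hψ : Integrable (fourierL2 ψ)) (hC : IsCompact C)
    {M : Matrix (Fin d) (Fin d) ℝ} {s : Fin d → ℝ} (hX : IsSignBlind (fourierSupport ψ) M s)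
    (f : L2On C) :
    HasSum (fun n => convOn f ψ (latticePoint M s n) ^ 2)
      (|M.det| * (2 ^ d * ∏ i, s i) * ∫ x, convOn f ψ x ^ 2) := by
  have hf := integrable_extendByZero hC f
  have h := hX.hasSum_sq_fourierInv (memLp_two_convSpectrum hf) (support_convSpectrum_ae_le _ ψ)
  rw [← integral_norm_sq_fourierInv (integrable_convSpectrum hψ hf) (memLp_two_convSpectrum hf),
    ← conv_eq_fourierInv_convSpectrum hψ hf, ← ofReal_convOn] at h
  simpa only [Complex.norm_real, Real.norm_eq_abs, sq_abs] using h

theorem eq_zero_of_convOn_eq_zero (hψ : Integrable (fourierL2 ψ)) (hψ0 : ψ ≠ 0)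
    (hC : IsCompact C) {f : L2On C} (h : conv (extendByZero f) ψ = 0) : f = 0 :=
  eq_zero_of_extendByZero_ae_eq_zero hC.measurableSet <|
    ae_eq_zero_of_conv_eq_zero hψ hψ0 (integrable_extendByZero hC f)
      (memLp_extendByZero hC.measurableSet f) hC.isBounded
      (support_extendByZero_subset f).eventuallyLE h

/-- `|f ∗ ψ|² - |g ∗ ψ|²` is the product of the analytic functions `(f - g) ∗ ψ` and
`(f + g) ∗ ψ`, and it vanishes as soon as it vanishes on the sampling set. -/
theorem eq_or_eq_neg_of_abs_convOn_eq (hψ : IsCompact (fourierSupport ψ)) (hψ0 : ψ ≠ 0)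
    (hC : IsCompact C) {M : Matrix (Fin d) (Fin d) ℝ} {s : Fin d → ℝ}
    (hX : IsSignBlind (fourierSupport ψ) M s) {f g : L2On C}
    (hfg : ∀ n, |convOn f ψ (latticePoint M s n)| = |convOn g ψ (latticePoint M s n)|) :
    f = g ∨ f = -g := by
  have hψ1 := integrable_fourierL2 hψ
  have hconv (k : L2On C) :=
    conv_eq_fourierInv_convSpectrum hψ1 (integrable_extendByZero hC k)
  have hint (k : L2On C) := integrable_convSpectrum hψ1 (integrable_extendByZero hC k)
  have hL2 (k : L2On C) := memLp_two_convSpectrum (ψ := ψ) (integrable_extendByZero hC k)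
  have hsupp (k : L2On C) := support_convSpectrum_ae_le (extendByZero k) ψ
  have hanalytic (k : L2On C) : AnalyticOnLines (conv (extendByZero k) ψ) :=
    hconv k ▸ analyticOnLines_fourierInv (hint k) hψ.isBounded (hsupp k)
  have hprod (x) : conv (extendByZero (f - g)) ψ x * conv (extendByZero (f + g)) ψ x = 0 := by
    rw [hconv, hconv]
    refine hX.fourierInv_mul_fourierInv_eq_zero (hint _) (hint _) (hL2 _) (hL2 _) (hsupp _)
      (hsupp _) (fun n => ?_) x
    rw [← hconv, ← hconv, ← ofReal_convOn, ← ofReal_convOn, ← Complex.ofReal_mul,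
      Complex.ofReal_eq_zero, convOn_sub hC.measurableSet, convOn_add hC.measurableSet]
    linear_combination (sq_eq_sq_iff_abs_eq_abs _ _).2 (hfg n)
  rcases (hanalytic _).eq_zero_or_eq_zero_of_mul_eq_zero (hanalytic _) hprod with h | h
  · exact .inl (sub_eq_zero.1 (eq_zero_of_convOn_eq_zero hψ1 hψ0 hC h))
  · exact .inr (eq_neg_of_add_eq_zero_left (eq_zero_of_convOn_eq_zero hψ1 hψ0 hC h))

theorem frame_bounds {Λ : Type*} {ψ : Λ → Lp ℝ 2 (volume : Measure (EuclideanSpace ℝ (Fin d)))}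
    (hψ : IsBandLimitedFrame ψ) (hC : IsCompact C) :
    ∃ A > 0, ∀ f : L2On C, Summable (fun l => ∫ x, convOn f (ψ l) x ^ 2) ∧
      A * ‖f‖ ^ 2 ≤ ∑' l, ∫ x, convOn f (ψ l) x ^ 2 := by
  obtain ⟨A, B, hA, -, hAB⟩ := hψ.frame
  refine ⟨A, hA, fun f => ?_⟩
  have hnonneg (l : Λ) : 0 ≤ ∫ x, convOn f (ψ l) x ^ 2 := by positivity
  have h := hAB (memLp_extendByZero hC.measurableSet f).toLp
  rw [norm_toLp_extendByZero hC.measurableSet] at h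
  simp only [eLpNorm_conv_toLp_extendByZero_sq (integrable_fourierL2 (hψ.bandLimited _)) hC] at h
  have hs : Summable fun l => ∫ x, convOn f (ψ l) x ^ 2 :=
    (ENNReal.summable_toReal (h.2.trans_lt ENNReal.ofReal_lt_top).ne).congr fun l =>
      ENNReal.toReal_ofReal (hnonneg l)
  rw [← ENNReal.ofReal_tsum_of_nonneg hnonneg hs] at h
  exact ⟨hs, (ENNReal.ofReal_le_ofReal_iff (tsum_nonneg hnonneg)).1 h.1⟩

end ConvOn

/-! ### The sampling operator -/

section Sampling

variable {d : ℕ}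

/-- The ratio of the density `|det M| ∏ᵢ 2sᵢ` of the lattice `(Mᵀ)⁻¹ D[2s]⁻¹ ℤᵈ` to the critical
density `|F|` for functions with spectrum in `F`. -/
noncomputable def oversamplingRatio (F : Set (EuclideanSpace ℝ (Fin d)))
    (M : Matrix (Fin d) (Fin d) ℝ) (s : Fin d → ℝ) : ℝ :=
  (volume.real F)⁻¹ * (|M.det| * (2 ^ d * ∏ i, s i))

theorem IsSignBlind.one_le_oversamplingRatio {F : Set (EuclideanSpace ℝ (Fin d))}
    {M : Matrix (Fin d) (Fin d) ℝ} {s : Fin d → ℝ} (hX : IsSignBlind F M s)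
    (hF : 0 < volume.real F) : 1 ≤ oversamplingRatio F M s := by
  have hFM : volume.real F ≤ |M.det| := by
    refine ENNReal.toReal_le_of_le_ofReal (abs_nonneg _) ?_
    rw [← volume_image_cube]
    exact measure_mono hX.subset
  have hs : 1 ≤ 2 ^ d * ∏ i, s i :=
    one_le_mul_of_one_le_of_one_le (one_le_pow₀ one_le_two)
      (Finset.one_le_prod fun i _ => hX.one_le i)
  rw [oversamplingRatio, inv_mul_eq_div, one_le_div hF]
  exact hFM.trans (le_mul_of_one_le_right (abs_nonneg _) hs)

theorem oversamplingRatio_le {F : Set (EuclideanSpace ℝ (Fin d))} (hF : 0 < volume.real F)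
    {M : Matrix (Fin d) (Fin d) ℝ} {s : Fin d → ℝ} {K : ℝ}
    (hK : |M.det| * ∏ i, s i ≤ K * volume.real F) : oversamplingRatio F M s ≤ 2 ^ d * K := by
  rw [oversamplingRatio, inv_mul_le_iff₀ hF]
  calc |M.det| * (2 ^ d * ∏ i, s i) = 2 ^ d * (|M.det| * ∏ i, s i) := by ring
    _ ≤ 2 ^ d * (K * volume.real F) := by gcongr
    _ = volume.real F * (2 ^ d * K) := by ring

variable {C : Set (EuclideanSpace ℝ (Fin d))} {Λ : Type*}
  {ψ : Λ → Lp ℝ 2 (volume : Measure (EuclideanSpace ℝ (Fin d)))}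
  {M : Λ → Matrix (Fin d) (Fin d) ℝ} {s : Λ → Fin d → ℝ}

/-- The functional `f ↦ |F_λ|^{-1/2} (f ∗ ψ_λ)(x_{λ,n})`, whose absolute value is the sample of `f`
with index `(λ, n)`. -/
noncomputable def sampleFunctional (ψ : Λ → Lp ℝ 2 (volume : Measure (EuclideanSpace ℝ (Fin d))))
    (M : Λ → Matrix (Fin d) (Fin d) ℝ) (s : Λ → Fin d → ℝ)
    (C : Set (EuclideanSpace ℝ (Fin d))) (p : Λ × (Fin d → ℤ)) : L2On C →L[ℝ] ℝ :=
  (volume.real (fourierSupport (ψ p.1)) ^ (-(1 / 2) : ℝ)) •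
    convFunctional (ψ p.1) C (latticePoint (M p.1) (s p.1) p.2)

theorem samples_eq_norm_sampleFunctional (hC : MeasurableSet C) (f : L2On C) :
    samples ψ M s f = fun p => ‖sampleFunctional ψ M s C p f‖ := by
  ext p
  rw [samples, sampleFunctional, smul_apply, norm_smul, convFunctional_apply hC,
    Real.norm_of_nonneg (Real.rpow_nonneg measureReal_nonneg _), Real.norm_eq_abs]

theorem memℓp_samples_iff (hC : MeasurableSet C) (f : L2On C) :
    Memℓp (samples ψ M s f) 2 ↔ Summable fun p => sampleFunctional ψ M s C p f ^ 2 := by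
  rw [memℓp_gen_iff (by norm_num), samples_eq_norm_sampleFunctional hC]
  simp

theorem hasSum_sq_sampleFunctional (hψ : IsBandLimitedFrame ψ)
    (hX : ∀ l, IsSignBlind (fourierSupport (ψ l)) (M l) (s l)) (hC : IsCompact C) (f : L2On C)
    (l : Λ) :
    HasSum (fun n => sampleFunctional ψ M s C (l, n) f ^ 2)
      (oversamplingRatio (fourierSupport (ψ l)) (M l) (s l) * ∫ x, convOn f (ψ l) x ^ 2) := by
  have h := (hasSum_sq_convOn_latticePoint (integrable_fourierL2 (hψ.bandLimited l)) hC (hX l)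
    f).mul_left (volume.real (fourierSupport (ψ l)))⁻¹
  rw [← mul_assoc] at h
  refine h.congr_fun fun n => ?_
  simp only [sampleFunctional, smul_apply, smul_eq_mul, mul_pow,
    convFunctional_apply hC.measurableSet]
  rw [← Real.rpow_mul_natCast measureReal_nonneg, ← Real.rpow_neg_one]
  norm_num

theorem summable_sq_sampleFunctional_iff (hψ : IsBandLimitedFrame ψ)
    (hX : ∀ l, IsSignBlind (fourierSupport (ψ l)) (M l) (s l)) (hC : IsCompact C) (f : L2On C) :
    Summable (fun p => sampleFunctional ψ M s C p f ^ 2) ↔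
      Summable fun l => oversamplingRatio (fourierSupport (ψ l)) (M l) (s l) *
        ∫ x, convOn f (ψ l) x ^ 2 := by
  rw [summable_prod_of_nonneg fun p => sq_nonneg _]
  simp only [(hasSum_sq_sampleFunctional hψ hX hC f _).tsum_eq,
    (hasSum_sq_sampleFunctional hψ hX hC f _).summable, implies_true, true_and]

theorem exists_mul_norm_sq_le_tsum_sq_sampleFunctional (hψ : IsBandLimitedFrame ψ)
    (hψ0 : ∀ l, ψ l ≠ 0) (hX : ∀ l, IsSignBlind (fourierSupport (ψ l)) (M l) (s l))
    (hC : IsCompact C) :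
    ∃ A > 0, ∀ f : L2On C, Summable (fun p => sampleFunctional ψ M s C p f ^ 2) →
      A * ‖f‖ ^ 2 ≤ ∑' p, sampleFunctional ψ M s C p f ^ 2 := by
  obtain ⟨A, hA, hframe⟩ := frame_bounds hψ hC
  refine ⟨A, hA, fun f hf => (hframe f).2.trans ?_⟩
  rw [hf.tsum_prod]
  simp only [(hasSum_sq_sampleFunctional hψ hX hC f _).tsum_eq]
  refine (hframe f).1.tsum_le_tsum (fun l => ?_)
    ((summable_sq_sampleFunctional_iff hψ hX hC f).1 hf)
  exact le_mul_of_one_le_left (by positivity) <|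
    (hX l).one_le_oversamplingRatio (volume_real_fourierSupport_pos (hψ.bandLimited l) (hψ0 l))

theorem exists_norm_le_mul_norm_of_eq_sampleFunctional (hψ : IsBandLimitedFrame ψ)
    (hψ0 : ∀ l, ψ l ≠ 0) (hX : ∀ l, IsSignBlind (fourierSupport (ψ l)) (M l) (s l))
    (hC : IsCompact C) :
    ∃ K : NNReal, ∀ f : L2On C, ∀ y : lp (fun _ : Λ × (Fin d → ℤ) => ℝ) 2,
      (∀ p, y p = sampleFunctional ψ M s C p f) → ‖f‖ ≤ K * ‖y‖ := by
  obtain ⟨A, hA, hbound⟩ := exists_mul_norm_sq_le_tsum_sq_sampleFunctional hψ hψ0 hX hC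
  refine ⟨(√A)⁻¹.toNNReal, fun f y hy => ?_⟩
  have hsum : HasSum (fun p => sampleFunctional ψ M s C p f ^ 2) (‖y‖ ^ 2) := by
    simpa [hy] using lp.hasSum_norm (p := 2) (by norm_num) y
  have hAf := (hbound f hsum.summable).trans_eq hsum.tsum_eq
  rw [Real.coe_toNNReal _ (by positivity), le_inv_mul_iff₀ (Real.sqrt_pos.2 hA)]
  refine le_of_sq_le_sq ?_ (norm_nonneg y)
  rwa [mul_pow, Real.sq_sqrt hA.le]

theorem samplingDomain_eq_univ (hψ : IsBandLimitedFrame ψ)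
    (hX : ∀ l, IsSignBlind (fourierSupport (ψ l)) (M l) (s l)) (hC : IsCompact C) {K : ℝ}
    (hK : ∀ l, oversamplingRatio (fourierSupport (ψ l)) (M l) (s l) ≤ K) :
    samplingDomain ψ M s hC = univ := by
  refine eq_univ_of_forall ?_
  rintro ⟨f⟩
  refine (memℓp_samples_iff hC.measurableSet f).2
    ((summable_sq_sampleFunctional_iff hψ hX hC f).2 ?_)
  obtain ⟨A, -, hframe⟩ := frame_bounds hψ hC
  exact .of_nonneg_of_le (fun l => (hasSum_sq_sampleFunctional hψ hX hC f l).nonneg fun n =>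
    sq_nonneg _) (fun l => mul_le_mul_of_nonneg_right (hK l) (by positivity))
    ((hframe f).1.mul_left K)

theorem samplingOp_injective (hψ : IsBandLimitedFrame ψ) (hψ0 : ∀ l, ψ l ≠ 0)
    (hX : ∀ l, IsSignBlind (fourierSupport (ψ l)) (M l) (s l)) (hC : IsCompact C) :
    Function.Injective (samplingOp ψ M s hC) := by
  rintro ⟨⟨f⟩, hf⟩ ⟨⟨g⟩, hg⟩ h
  refine Subtype.ext (Quotient.sound ?_)
  rcases isEmpty_or_nonempty Λ with hΛ | ⟨⟨l⟩⟩
  · obtain ⟨K, hK⟩ := exists_norm_le_mul_norm_of_eq_sampleFunctional hψ hψ0 hX hC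
    have hzero (k : L2On C) : k = 0 := by simpa using hK k 0 fun p => isEmptyElim p.1
    exact .inl ((hzero f).trans (hzero g).symm)
  · have hF := volume_real_fourierSupport_pos (hψ.bandLimited l) (hψ0 l)
    refine eq_or_eq_neg_of_abs_convOn_eq (hψ.bandLimited l) (hψ0 l) hC (hX l) fun n => ?_
    have hn : samples ψ M s f (l, n) = samples ψ M s g (l, n) :=
      congrFun (congrArg Subtype.val h) (l, n)
    exact mul_left_cancel₀ (Real.rpow_pos_of_pos hF _).ne' hn

theorem SignQuotient.continuous_mk {V : Type*} [NormedAddCommGroup V] :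
    Continuous (SignQuotient.mk : V → SignQuotient V) := by
  refine LipschitzWith.continuous (K := 1) (LipschitzWith.of_dist_le_mul fun f g => ?_)
  rw [SignQuotient.dist_mk, dist_eq_norm, NNReal.coe_one, one_mul]
  exact min_le_left _ _

theorem isClosedMap_samplingOp (hψ : IsBandLimitedFrame ψ) (hψ0 : ∀ l, ψ l ≠ 0)
    (hX : ∀ l, IsSignBlind (fourierSupport (ψ l)) (M l) (s l)) (hC : IsCompact C) :
    IsClosedMap (samplingOp ψ M s hC) := by
  intro S hS
  obtain ⟨A, hA, rfl⟩ := isClosed_induced_iff.1 hS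
  obtain ⟨K, hK⟩ := exists_norm_le_mul_norm_of_eq_sampleFunctional hψ hψ0 hX hC
  convert isClosed_setOf_norm_coefficients (by norm_num) (sampleFunctional ψ M s C) hK
    (hA.preimage SignQuotient.continuous_mk) using 1
  have hsamples (f : L2On C) := samples_eq_norm_sampleFunctional (ψ := ψ) (M := M) (s := s)
    hC.measurableSet f
  ext z
  constructor
  · rintro ⟨⟨⟨f⟩, hf⟩, hfA, rfl⟩
    exact ⟨f, hfA, congrFun (hsamples f)⟩
  · rintro ⟨f, hfA, hz⟩
    have hzf : samples ψ M s f = z := (hsamples f).trans (funext hz).symm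
    have hf : Memℓp (samples ψ M s f) 2 := hzf ▸ lp.memℓp z
    exact ⟨⟨SignQuotient.mk f, hf⟩, hfA, Subtype.ext hzf⟩

end Sampling

end SignRetrieval

theorem theorem5p1_general {d : ℕ} {Λ : Type*}
    (ψ : Λ → Lp ℝ 2 (volume : Measure (EuclideanSpace ℝ (Fin d))))
    (hψ : SignRetrieval.IsBandLimitedFrame ψ) (hψ0 : ∀ l, ψ l ≠ 0)
    (M : Λ → Matrix (Fin d) (Fin d) ℝ) (s : Λ → Fin d → ℝ)
    (hX : ∀ l, SignRetrieval.IsSignBlind (SignRetrieval.fourierSupport (ψ l)) (M l) (s l))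
    (C : Set (EuclideanSpace ℝ (Fin d))) (hC : IsCompact C) :
    ((∃ K : ℝ, ∀ l, |(M l).det| * ∏ i, s l i ≤
        K * volume.real (SignRetrieval.fourierSupport (ψ l))) →
      SignRetrieval.samplingDomain ψ M s hC = univ) ∧
    ∃ hinj : Function.Injective (SignRetrieval.samplingOp ψ M s hC),
      IsClosed (range (SignRetrieval.samplingOp ψ M s hC)) ∧
      Continuous fun h : range (SignRetrieval.samplingOp ψ M s hC) =>
        (((Equiv.ofInjective (SignRetrieval.samplingOp ψ M s hC) hinj).symm h :
          SignRetrieval.samplingDomain ψ M s hC) :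
            SignRetrieval.SignQuotient (SignRetrieval.L2On C)) := by
  have hclosed := SignRetrieval.isClosedMap_samplingOp hψ hψ0 hX hC
  have hinj := SignRetrieval.samplingOp_injective hψ hψ0 hX hC
  refine ⟨fun ⟨K, hK⟩ => SignRetrieval.samplingDomain_eq_univ hψ hX hC fun l =>
    SignRetrieval.oversamplingRatio_le
      (SignRetrieval.volume_real_fourierSupport_pos (hψ.bandLimited l) (hψ0 l)) (hK l),
    hinj, hclosed.isClosed_range, continuous_subtype_val.comp
      (SignRetrieval.continuous_ofInjective_symm_of_isClosedMap hclosed hinj)⟩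

theorem theorem5p1 {d : ℕ} {Λ : Type*}
    (ψ : Λ → Lp ℝ 2 (volume : Measure (EuclideanSpace ℝ (Fin d))))
    (hψ : SignRetrieval.IsBandLimitedFrame ψ)
    (hoverlap : SignRetrieval.GoodFSupportOverlap ψ)
    (M : Λ → Matrix (Fin d) (Fin d) ℝ) (s : Λ → Fin d → ℝ)
    (hX : ∀ l, SignRetrieval.IsSignBlind (SignRetrieval.fourierSupport (ψ l)) (M l) (s l))
    (C : Set (EuclideanSpace ℝ (Fin d))) (hC : IsCompact C) :
    -- `T` is defined on all of `L²(C, ℝ) / {-1, 1}` if the sampling densities are comparable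
    -- to the measures `|F_λ|`
    ((∃ K : ℝ, ∀ l, |(M l).det| * ∏ i, s l i ≤
        K * volume.real (SignRetrieval.fourierSupport (ψ l))) →
      SignRetrieval.samplingDomain ψ M s hC = univ) ∧
    -- `T` is injective, its range is closed, and its inverse on the range is continuous
    ∃ hinj : Function.Injective (SignRetrieval.samplingOp ψ M s hC),
      IsClosed (range (SignRetrieval.samplingOp ψ M s hC)) ∧
      Continuous fun h : range (SignRetrieval.samplingOp ψ M s hC) =>
        (((Equiv.ofInjective (SignRetrieval.samplingOp ψ M s hC) hinj).symm h :
          SignRetrieval.samplingDomain ψ M s hC) :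
            SignRetrieval.SignQuotient (SignRetrieval.L2On C)) := by
  obtain ⟨U, hU, -⟩ := hoverlap
  exact theorem5p1_general ψ hψ (fun l => SignRetrieval.ne_zero_of_nonempty_fourierSupport
    ((hU l).1.mono (hU l).2.2)) M s hX C hC
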